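/- Let $n,m$ be positive integers and let $\eta=(\eta_1,\dots,\eta_n)$ be a vector of integers in the alcove $$\mathcal A^{\tilde C_n}_m=\{(x_1,\dots,x_n)\in\mathbb R^n : m>x_1>x_2>\dots>x_n>0\}.$$ Write $|\eta|=\eta_1+\dots+\eta_n$, and let $N_k(\eta)$ be the number of walks $w_0,w_1,\dots,w_k$ with $w_0=\eta$, all of whose points lie in $\mathcal A^{\tilde C_n}_m$, and all of whose steps $w_{s+1}-w_s$ are standard steps, that is, belong to $\{\pm e_1,\dots,\pm e_n\}$ ($e_j$ the $j$-th unit vector); the end point $w_k$ is arbitrary. Put $$F_k=\frac{2^{2n^2-n}}{m^n}\left(\frac{2\sin\frac{n\pi}{2m}\cos\frac{(n+1)\pi}{2m}}{\sin\frac{\pi}{2m}}\right)^{k}\prod_{1\le h<t\le n}\left(\sin\frac{\pi(\eta_h-\eta_t)}{2m}\cdot\sin\frac{\pi(t-h)}{2m}\right)\prod_{1\le h\le t\le n}\left(\sin\frac{\pi(\eta_t+\eta_h)}{2m}\cdot\sin\frac{\pi(t+h)}{2m}\right),$$ $$Q=\prod_{h=0}^{n}\prod_{t=1}^{n}\frac{\sin\frac{\pi(t-h+m-1)}{2m}}{\sin\frac{\pi(t-h+n)}{2m}},\qquad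 P=\prod_{h=1}^{n+1}\prod_{t=1}^{n}\left|\sin\frac{(2t-2h+1)\pi}{2m}\right|.$$ Then, as $k\to\infty$ (through all positive integers), the following asymptotic equivalences hold, where $a_k\sim b_k$ means $a_k-b_k=o(b_k)$ (in particular $a_k=b_k$ for all large $k$ if $b_k=0$ for all large $k$, which occurs when $n=m-1$). If $m$ and $n$ are both even, then $$N_k(\eta)\sim F_k\left(Q+(-1)^{|\eta|+k+\frac n2}\,2^{-n^2}\,\frac{\prod_{h=1}^{n/2}\tan^2\frac{(2h-1)\pi}{2m}}{P}\right).$$ If $m$ is even and $n$ is odd, then $$N_k(\eta)\sim F_k\left(Q+(-1)^{|\eta|+k+\frac{n+1}2}\,2^{-n^2}\,\frac{\prod_{h=1}^{(n+1)/2}\tan^2\frac{(2h-1)\pi}{2m}}{P}\right).$$ If $m$ is odd and $n$ is even, then $$N_k(\eta)\sim F_k\left(Q+(-1)^{|\eta|+k+\frac n2}\,2^{-n^2}\left(\prod_{h=1}^{n/2}\frac{\sin^2\frac{(2h-1)\pi}{2m}}{\cos^2\frac{h\pi}{m}}\right)\frac1P\right).$$ If $m$ and $n$ are both odd, then $$N_k(\eta)\sim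 F_k\,Q.$$ -/

import Mathlib

open Filter Asymptotics

/-- The (scaled) alcove of type `C̃_n`: the points with `m > x₁ > x₂ > ⋯ > xₙ > 0`. -/
def alcoveC (n : ℕ) (m : ℝ) : Set (Fin n → ℝ) :=
  {x | StrictAnti x ∧ ∀ i, 0 < x i ∧ x i < m}

/-- `y` is reached from `x` by one standard step `e_j` or `-e_j`. -/
def IsStandardStep {n : ℕ} (x y : Fin n → ℤ) : Prop :=
  ∃ j : Fin n, y = x + Pi.single j 1 ∨ y = x - Pi.single j 1

/-- The lattice walks `w 0, w 1, …, w k` with exactly `k` standard steps which start at `η`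
(the end point `w k` being arbitrary) and all of whose points lie in the alcove of type `C̃_n`. -/
def standardWalksC (n m : ℕ) (η : Fin n → ℤ) (k : ℕ) : Set (Fin (k + 1) → Fin n → ℤ) :=
  {w | w 0 = η ∧ (∀ s : Fin k, IsStandardStep (w s.castSucc) (w s.succ)) ∧
    ∀ s, (fun i => (w s i : ℝ)) ∈ alcoveC n (m : ℝ)}

/-- There are finitely many such walks, so that their `Set.ncard` is the actual number. -/
theorem standardWalksC_finite (n m : ℕ) (η : Fin n → ℤ) (k : ℕ) :
    (standardWalksC n m η k).Finite := by
  refine (Set.Finite.pi' (t := fun _ : Fin (k + 1) =>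
    {x : Fin n → ℤ | ∀ i, x i ∈ Set.Icc (0 : ℤ) m})
    (fun _ => Set.Finite.pi' (fun _ => Set.finite_Icc _ _))).subset ?_
  rintro w ⟨-, -, hw⟩ s i
  have h : (0 : ℝ) < (w s i : ℝ) ∧ (w s i : ℝ) < (m : ℝ) := (hw s).2 i
  exact ⟨by exact_mod_cast h.1.le, by exact_mod_cast h.2.le⟩

noncomputable section

/-- The number of walks with exactly `k` standard steps which start at `η` and stay in the
alcove of type `C̃_n`. -/
def numStandardWalksC (n m : ℕ) (η : Fin n → ℤ) (k : ℕ) : ℕ :=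
  (standardWalksC n m η k).ncard

/-- The common factor of the asymptotic formulas. The indices `h`, `t` of type `Fin n` start at `0`,
so that the index written `t` in the mathematics is `t + 1` here. -/
def commonFactorC (n m : ℕ) (η : Fin n → ℤ) (k : ℕ) : ℝ :=
  (2 : ℝ) ^ (2 * (n : ℤ) ^ 2 - n) / (m : ℝ) ^ n *
    (2 * Real.sin (n * Real.pi / (2 * m)) * Real.cos ((n + 1) * Real.pi / (2 * m)) /
      Real.sin (Real.pi / (2 * m))) ^ k *
    (∏ h : Fin n, ∏ t ∈ Finset.Ioi h,
      (Real.sin (Real.pi * ((η h : ℝ) - η t) / (2 * m)) *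
        Real.sin (Real.pi * (((t : ℕ) + 1 : ℝ) - ((h : ℕ) + 1)) / (2 * m)))) *
    ∏ h : Fin n, ∏ t ∈ Finset.Ici h,
      (Real.sin (Real.pi * ((η t : ℝ) + η h) / (2 * m)) *
        Real.sin (Real.pi * (((t : ℕ) + 1 : ℝ) + ((h : ℕ) + 1)) / (2 * m)))

/-- The product `∏_{h=0}^n ∏_{t=1}^n sin(π(t-h+m-1)/2m) / sin(π(t-h+n)/2m)`. -/
def sineQuotientC (n m : ℕ) : ℝ :=
  ∏ h ∈ Finset.Icc 0 n, ∏ t ∈ Finset.Icc 1 n,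
    Real.sin (Real.pi * ((t : ℝ) - h + (m - 1)) / (2 * m)) /
      Real.sin (Real.pi * ((t : ℝ) - h + n) / (2 * m))

/-- The product `∏_{h=1}^{n+1} ∏_{t=1}^n |sin((2t-2h+1)π/2m)|`. -/
def absSineProductC (n m : ℕ) : ℝ :=
  ∏ h ∈ Finset.Icc 1 (n + 1), ∏ t ∈ Finset.Icc 1 n,
    |Real.sin ((2 * (t : ℝ) - 2 * h + 1) * Real.pi / (2 * m))|

end

/-! The functions sin(rxπ/m) with 0 < r < m are the eigenvectors of the path 1, …, m-1, so ∏ sin(r_i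
η_i π/m) is an eigenfunction of the sum over all standard steps, with eigenvalue λ_r = Σ 2cos(r_i
π/m). Let S(r), here `modeSum`, be the sum of det(sin(r_i x_j π/m)) over all end points x in the
alcove. Then N_k(η) = (2/m)^n Σ_r λ_r^k ∏ sin(r_i η_i π/m) S(r) (`numStandardWalksC_eq`): the right
side satisfies the recursion of the walks, vanishes on every wall (S is alternating in r, sines
vanish at 0 and m), and is 1 for k = 0 by orthogonality. Among families of distinct modes |λ_r| is
largest exactly for the permutations of 1, …, n and of m-1, …, m-n, with opposite values ±λ. The
first family gives the term with Q, the second the term whose sign alternates with k.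

The core is a product formula for S(r). In the exterior algebra put Ω = (1+e_{m-1})⋯(1+e_1); then
S(r) is the scalar part of Ω contracted by all modes (`contractScalar_wedgeSum`). Contraction by any
f acts on Ω as multiplication by a scalar plus a vector (`contractLeft_wedgeSum`). For an even mode
the scalar is zero, and even modes vanish on the vectors of even modes. An odd mode o takes on the
vector of an even mode e the value w_e w_o / (cos(eπ/m) - cos(oπ/m)). Contracting by the even modes
first leaves a Cauchy determinant if the odd modes are as many or one more. If the even modes are
one more, S = 0; this happens for m-1, …, m-n when m and n are odd.

The reflection r ↦ m - r yields S(high)/S(low), and identities between products of sines give Q =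
1/(2^(n²) P) and express F_k through S(low). Finally S(low) ± S(high) > 0 when n + 1 < m, so the two
dominating terms never cancel; when n + 1 = m, λ = 0 and both sides vanish for k > 0. -/

/-! ### Contractions of the generating element of all increasing sequences -/

open CliffordAlgebra in
/-- Iterated contraction by the functionals `f 0, f 1, …`, in this order. -/
noncomputable def iterContract {V : Type*} [AddCommGroup V] [Module ℝ V] :
    (n : ℕ) → (Fin n → Module.Dual ℝ V) → ExteriorAlgebra ℝ V → ExteriorAlgebra ℝ V
  | 0, _, X => X
  | n + 1, f, X => iterContract n (fun i => f i.succ) (contractLeft (f 0) X)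

section IterContract

variable {V : Type*} [AddCommGroup V] [Module ℝ V]

theorem iterContract_add (n : ℕ) (f : Fin n → Module.Dual ℝ V) (X Y : ExteriorAlgebra ℝ V) :
    iterContract n f (X + Y) = iterContract n f X + iterContract n f Y := by
  induction n generalizing X Y with
  | zero => rfl
  | succ n ih => simp [iterContract, ih]

theorem iterContract_smul (n : ℕ) (f : Fin n → Module.Dual ℝ V) (a : ℝ)
    (X : ExteriorAlgebra ℝ V) : iterContract n f (a • X) = a • iterContract n f X := by
  induction n generalizing X with
  | zero => rfl
  | succ n ih => simp [iterContract, ih]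

theorem iterContract_neg (n : ℕ) (f : Fin n → Module.Dual ℝ V)
    (X : ExteriorAlgebra ℝ V) : iterContract n f (-X) = -iterContract n f X := by
  have := iterContract_smul n f (-1) X
  simpa using this

theorem iterContract_succ_last (n : ℕ) (f : Fin (n + 1) → Module.Dual ℝ V)
    (X : ExteriorAlgebra ℝ V) :
    iterContract (n + 1) f X = CliffordAlgebra.contractLeft (f (Fin.last n))
      (iterContract n (fun i => f i.castSucc) X) := by
  induction n generalizing X with
  | zero => rfl
  | succ n ih =>
    rw [iterContract, ih]
    rfl

theorem iterContract_append (p k : ℕ) (f : Fin (p + k) → Module.Dual ℝ V)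
    (X : ExteriorAlgebra ℝ V) :
    iterContract (p + k) f X = iterContract k (fun j => f (Fin.natAdd p j))
      (iterContract p (fun i => f (Fin.castAdd k i)) X) := by
  induction k with
  | zero => rfl
  | succ k ih =>
    rw [iterContract_succ_last k]
    refine (iterContract_succ_last (p + k) f X).trans ?_
    rw [ih]
    rfl

theorem contractLeft_ι_mul_exterior (d : Module.Dual ℝ V) (b : V) (X : ExteriorAlgebra ℝ V) :
    CliffordAlgebra.contractLeft d (ExteriorAlgebra.ι ℝ b * X) =
      d b • X - ExteriorAlgebra.ι ℝ b * CliffordAlgebra.contractLeft d X :=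
  CliffordAlgebra.contractLeft_ι_mul d b X

/-- The scalar part of an iterated contraction. -/
noncomputable def contractScalar (n : ℕ) (f : Fin n → Module.Dual ℝ V)
    (X : ExteriorAlgebra ℝ V) : ℝ :=
  ExteriorAlgebra.algebraMapInv (iterContract n f X)

/-- Laplace expansion: contraction is an antiderivation, so `ι b` is absorbed by one functional
after another with alternating sign. The term in which no functional absorbs it has scalar part
zero. -/
theorem contractScalar_ι_mul (n : ℕ) (f : Fin (n + 1) → Module.Dual ℝ V) (b : V)
    (X : ExteriorAlgebra ℝ V) :
    contractScalar (n + 1) f (ExteriorAlgebra.ι ℝ b * X) =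
      ∑ j : Fin (n + 1), (-1) ^ (j : ℕ) * f j b *
        contractScalar n (fun i => f (j.succAbove i)) X := by
  have base : ∀ (Y : ExteriorAlgebra ℝ V),
      ExteriorAlgebra.algebraMapInv (ExteriorAlgebra.ι ℝ b * Y) = (0 : ℝ) := by
    intro Y; simp [ExteriorAlgebra.algebraMapInv]
  induction n generalizing X with
  | zero =>
    simp [contractScalar, iterContract, contractLeft_ι_mul_exterior, base]
  | succ n ih =>
    have h1 : contractScalar (n + 2) f (ExteriorAlgebra.ι ℝ b * X) =
        f 0 b * contractScalar (n + 1) (fun i => f i.succ) X -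
          contractScalar (n + 1) (fun i => f i.succ)
            (ExteriorAlgebra.ι ℝ b * CliffordAlgebra.contractLeft (f 0) X) := by
      rw [contractScalar, iterContract, contractLeft_ι_mul_exterior, sub_eq_add_neg,
        iterContract_add, iterContract_neg, iterContract_smul]
      simp [contractScalar, sub_eq_add_neg]
    rw [h1, ih, Fin.sum_univ_succ (n := n + 1), sub_eq_add_neg, ← Finset.sum_neg_distrib]
    congr 1
    · simp only [Fin.val_zero, pow_zero, one_mul, Fin.zero_succAbove]
    · refine Finset.sum_congr rfl fun j _ => ?_
      have : contractScalar (n + 1) (fun i => f (j.succ.succAbove i)) X =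
          contractScalar n (fun i => f (j.succAbove i).succ)
            (CliffordAlgebra.contractLeft (f 0) X) := by
        rw [contractScalar, iterContract]
        congr 2
        ext i
        simp
      rw [this]
      simp [pow_succ]

theorem iterContract_ι_mul_of_forall_eq_zero (n : ℕ) (f : Fin n → Module.Dual ℝ V) (b : V)
    (X : ExteriorAlgebra ℝ V) (hf : ∀ i, f i b = 0) :
    iterContract n f (ExteriorAlgebra.ι ℝ b * X) =
      (-1 : ℝ) ^ n • (ExteriorAlgebra.ι ℝ b * iterContract n f X) := by
  induction n generalizing X with
  | zero => simp [iterContract]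
  | succ n ih =>
    rw [iterContract, contractLeft_ι_mul_exterior, hf, zero_smul, zero_sub, iterContract_neg,
      ih _ _ fun i => hf i.succ, pow_succ, mul_neg_one, neg_smul]
    rfl

/-- Expansion of a contraction along the first of the functionals `e`, when these multiply `Ω` by
the vectors `b` and vanish on all of them. -/
theorem contractScalar_iterContract_succ {p k : ℕ} (e : Fin (p + 1) → Module.Dual ℝ V)
    (o : Fin (k + 1) → Module.Dual ℝ V) (b : V) (Ω : ExteriorAlgebra ℝ V)
    (h0 : CliffordAlgebra.contractLeft (e 0) Ω = ExteriorAlgebra.ι ℝ b * Ω)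
    (hb : ∀ i : Fin p, e i.succ b = 0) :
    contractScalar (k + 1) o (iterContract (p + 1) e Ω) =
      (-1) ^ p * ∑ j : Fin (k + 1), (-1) ^ (j : ℕ) * o j b *
        contractScalar k (fun i => o (j.succAbove i))
          (iterContract p (fun i => e i.succ) Ω) := by
  rw [iterContract, h0, iterContract_ι_mul_of_forall_eq_zero _ _ _ _ hb, contractScalar,
    iterContract_smul, map_smul, smul_eq_mul]
  congr 1
  exact contractScalar_ι_mul k o b _

/-- Up to sign the functionals `e` turn `Ω` into the product of the vectors `b` times `Ω`, because
they kill every `b j`. The equally many `o` must then absorb all these vectors, which leaves only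
the scalar part of `Ω`; the recursion is the expansion of a determinant along its first row. -/
theorem contractScalar_eq_det {p : ℕ} (e o : Fin p → Module.Dual ℝ V) (b : Fin p → V)
    (Ω : ExteriorAlgebra ℝ V)
    (he : ∀ i, CliffordAlgebra.contractLeft (e i) Ω = ExteriorAlgebra.ι ℝ (b i) * Ω)
    (heb : ∀ i j, e i (b j) = 0) :
    contractScalar p o (iterContract p e Ω) =
      (∏ i ∈ Finset.range p, (-1) ^ i) * ExteriorAlgebra.algebraMapInv Ω *
        (Matrix.of fun i j => o j (b i)).det := by
  induction p with
  | zero => simp [contractScalar, iterContract]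
  | succ p ih =>
    rw [contractScalar_iterContract_succ e o (b 0) Ω (he 0) fun i => heb _ _,
      Matrix.det_succ_row_zero, Finset.prod_range_succ, Finset.mul_sum, Finset.mul_sum]
    refine Finset.sum_congr rfl fun j _ => ?_
    rw [ih (fun i => e i.succ) (fun i => o (j.succAbove i)) (fun i => b i.succ)
      (fun i => he _) fun i k => heb _ _]
    simp only [Matrix.of_apply, Matrix.submatrix]
    ring

/-- With one functional more than vectors, the surplus one contracts `Ω` itself. This is the last
row of the determinant. -/
theorem contractScalar_eq_det_snoc {p : ℕ} (e : Fin p → Module.Dual ℝ V)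
    (o : Fin (p + 1) → Module.Dual ℝ V) (b : Fin p → V)
    (Ω : ExteriorAlgebra ℝ V)
    (he : ∀ i, CliffordAlgebra.contractLeft (e i) Ω = ExteriorAlgebra.ι ℝ (b i) * Ω)
    (heb : ∀ i j, e i (b j) = 0) :
    contractScalar (p + 1) o (iterContract p e Ω) =
      (∏ i ∈ Finset.range p, (-1) ^ i) *
        (Matrix.of fun i j => Fin.snoc (α := fun _ => ℝ) (fun i => o j (b i))
          (contractScalar 1 (fun _ => o j) Ω) i).det := by
  induction p with
  | zero =>
    simp only [Nat.reduceAdd, Finset.range_zero, Finset.prod_empty, one_mul,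
      Matrix.det_unique, Matrix.of_apply, iterContract]
    rw [show (default : Fin 1) = Fin.last 0 from rfl, Fin.snoc_last]
    congr
    ext i
    rw [Fin.fin_one_eq_zero i]
    rfl
  | succ p ih =>
    rw [contractScalar_iterContract_succ e o (b 0) Ω (he 0) fun i => heb _ _,
      Matrix.det_succ_row_zero, Finset.prod_range_succ, Finset.mul_sum, Finset.mul_sum]
    refine Finset.sum_congr rfl fun j _ => ?_
    rw [ih (fun i => e i.succ) (fun i => o (j.succAbove i)) (fun i => b i.succ)
      (fun i => he _) fun i k => heb _ _]
    have h : (Matrix.of fun (i : Fin (p + 2)) (j : Fin (p + 2)) =>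
        Fin.snoc (α := fun _ => ℝ) (fun i => o j (b i))
          (contractScalar 1 (fun _ => o j) Ω) i).submatrix Fin.succ j.succAbove =
        Matrix.of fun i i' => Fin.snoc (α := fun _ => ℝ) (fun i => o (j.succAbove i') (b i.succ))
          (contractScalar 1 (fun _ => o (j.succAbove i')) Ω) i := by
      ext i i'
      simp only [Matrix.submatrix_apply, Matrix.of_apply]
      induction i using Fin.lastCases with
      | last => rw [Fin.succ_last, Fin.snoc_last, Fin.snoc_last]
      | cast i => rw [Fin.succ_castSucc, Fin.snoc_castSucc, Fin.snoc_castSucc]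
    rw [h, Matrix.of_apply, show (0 : Fin (p + 1 + 1)) = (0 : Fin (p + 1)).castSucc from rfl,
      Fin.snoc_castSucc]
    ring

/-- With too few functionals a vector factor survives, and it has no scalar part. -/
theorem contractScalar_eq_zero {p : ℕ} (e : Fin (p + 1) → Module.Dual ℝ V)
    (o : Fin p → Module.Dual ℝ V) (b : Fin (p + 1) → V) (Ω : ExteriorAlgebra ℝ V)
    (he : ∀ i, CliffordAlgebra.contractLeft (e i) Ω = ExteriorAlgebra.ι ℝ (b i) * Ω)
    (heb : ∀ i j, e i (b j) = 0) :
    contractScalar p o (iterContract (p + 1) e Ω) = 0 := by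
  induction p with
  | zero => simp [contractScalar, iterContract, he, ExteriorAlgebra.algebraMapInv]
  | succ p ih =>
    rw [contractScalar_iterContract_succ e o (b 0) Ω (he 0) fun i => heb _ _]
    rw [Finset.sum_eq_zero, mul_zero]
    intro j _
    rw [ih (fun i => e i.succ) (fun i => o (j.succAbove i)) (fun i => b i.succ)
      (fun i => he _) fun i k => heb _ _, mul_zero]

end IterContract

/-! ### Sums over decreasing sequences in the exterior algebra -/

/-- The strictly decreasing sequences of length `n` of integers between `1` and `M`. -/
noncomputable def strictAntiSeqs (n M : ℕ) : Finset (Fin n → ℤ) :=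
  (Fintype.piFinset fun _ => Finset.Icc (1 : ℤ) M).filter fun x => ∀ i j, i < j → x j < x i

theorem mem_strictAntiSeqs {n M : ℕ} {x : Fin n → ℤ} :
    x ∈ strictAntiSeqs n M ↔ (∀ i, 1 ≤ x i ∧ x i ≤ M) ∧ StrictAnti x := by
  simp [strictAntiSeqs, StrictAnti]

theorem strictAntiSeqs_zero (M : ℕ) : strictAntiSeqs 0 M = {Fin.elim0} := by
  ext x
  simp only [mem_strictAntiSeqs, Finset.mem_singleton]
  exact ⟨fun _ => Subsingleton.elim _ _, fun _ => ⟨fun i => i.elim0, fun i => i.elim0⟩⟩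

theorem sum_strictAntiSeqs_succ {n M : ℕ} (g : (Fin (n + 1) → ℤ) → ℝ) :
    ∑ x ∈ strictAntiSeqs (n + 1) (M + 1), g x = ∑ x ∈ strictAntiSeqs (n + 1) M, g x +
      ∑ y ∈ strictAntiSeqs n M, g (Fin.cons (M + 1 : ℤ) y) := by
  rw [← Finset.sum_filter_not_add_sum_filter _ fun x : Fin (n + 1) → ℤ => x 0 = M + 1]
  congr 1
  · refine Finset.sum_congr ?_ fun _ _ => rfl
    ext x
    simp only [Finset.mem_filter, mem_strictAntiSeqs]
    constructor
    · rintro ⟨⟨h1, h2⟩, h3⟩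
      refine ⟨fun i => ⟨(h1 i).1, ?_⟩, h2⟩
      have := h2.antitone (Fin.zero_le i)
      have := (h1 0).2
      push_cast at this
      omega
    · rintro ⟨h1, h2⟩
      refine ⟨⟨fun i => ⟨(h1 i).1, ?_⟩, h2⟩, ?_⟩
      · have := (h1 i).2
        push_cast
        omega
      · have := (h1 0).2
        omega
  · refine Finset.sum_bij' (fun x _ => fun i => x i.succ) (fun y _ => Fin.cons (M + 1 : ℤ) y)
      ?_ ?_ ?_ ?_ ?_
    · intro x hx
      simp only [Finset.mem_filter, mem_strictAntiSeqs] at hx ⊢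
      obtain ⟨⟨h1, h2⟩, h3⟩ := hx
      refine ⟨fun i => ⟨(h1 _).1, ?_⟩, fun i j hij => h2 (Fin.succ_lt_succ_iff.2 hij)⟩
      have := h2 (Fin.succ_pos i)
      omega
    · intro y hy
      simp only [Finset.mem_filter, mem_strictAntiSeqs] at hy ⊢
      obtain ⟨h1, h2⟩ := hy
      refine ⟨⟨fun i => ?_, fun i j hij => ?_⟩, rfl⟩
      · induction i using Fin.cases with
        | zero => simp
        | succ i => simpa using ⟨(h1 i).1, by have := (h1 i).2; omega⟩
      · induction j using Fin.cases with
        | zero => exact absurd hij (by simp)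
        | succ j =>
          induction i using Fin.cases with
          | zero => have := (h1 j).2; simp; omega
          | succ i => simpa using h2 (Fin.succ_lt_succ_iff.1 hij)
    · intro x hx
      simp only [Finset.mem_filter] at hx
      rw [← hx.2]
      exact Fin.cons_self_tail x
    · intro y hy
      rfl
    · intro x hx
      simp only [Finset.mem_filter] at hx
      rw [← hx.2]
      congr 1
      exact (Fin.cons_self_tail x).symm

/-- The functional on finitely supported sequences which pairs with `f`. -/
noncomputable def seqDual (f : ℤ → ℝ) : Module.Dual ℝ (ℤ →₀ ℝ) := Finsupp.linearCombination ℝ f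

theorem seqDual_single (f : ℤ → ℝ) (y : ℤ) (a : ℝ) : seqDual f (Finsupp.single y a) = a * f y := by
  simp [seqDual]

/-- The sum of all products `e_{x₁} ∧ e_{x₂} ∧ ⋯` with `M ≥ x₁ > x₂ > ⋯ ≥ 1`. -/
noncomputable def wedgeSum : ℕ → ExteriorAlgebra ℝ (ℤ →₀ ℝ)
  | 0 => 1
  | M + 1 => wedgeSum M + ExteriorAlgebra.ι ℝ (Finsupp.single (M + 1 : ℤ) 1) * wedgeSum M

theorem algebraMapInv_wedgeSum (M : ℕ) : ExteriorAlgebra.algebraMapInv (wedgeSum M) = (1 : ℝ) := by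
  induction M with
  | zero => simp [wedgeSum]
  | succ M ih => simp only [wedgeSum, map_add, map_mul, ih]; simp [ExteriorAlgebra.algebraMapInv]

/-- The two summands of `wedgeSum (M + 1)` correspond to the sequences that avoid `M + 1` and to
those that start with it. For the latter, `contractScalar_ι_mul` is the expansion of the determinant
along its first column. -/
theorem contractScalar_wedgeSum (n M : ℕ) (f : Fin n → ℤ → ℝ) :
    contractScalar n (fun i => seqDual (f i)) (wedgeSum M) =
      ∑ x ∈ strictAntiSeqs n M, (Matrix.of fun i j => f i (x j)).det := by
  induction M generalizing n with
  | zero =>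
    cases n with
    | zero => simp [strictAntiSeqs_zero, contractScalar, iterContract, wedgeSum]
    | succ n =>
      rw [Finset.sum_eq_zero]
      · have : iterContract n (fun i => seqDual (f i.succ)) 0 = 0 := by
          simpa using iterContract_smul n (fun i => seqDual (f i.succ)) 0 0
        simp only [contractScalar, iterContract, wedgeSum]
        erw [CliffordAlgebra.contractLeft_one (Q := 0), this]
        simp
      · intro x hx
        have := (mem_strictAntiSeqs.1 hx).1 0
        simp at this
        omega
  | succ M ih =>
    cases n with
    | zero => simp [strictAntiSeqs_zero, contractScalar, iterContract, algebraMapInv_wedgeSum]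
    | succ n =>
      have hadd : ∀ X Y, contractScalar (n + 1) (fun i => seqDual (f i)) (X + Y) =
          contractScalar (n + 1) (fun i => seqDual (f i)) X +
          contractScalar (n + 1) (fun i => seqDual (f i)) Y := by
        intro X Y
        simp [contractScalar, iterContract_add]
      rw [wedgeSum, hadd, ih, contractScalar_ι_mul, sum_strictAntiSeqs_succ]
      congr 1
      simp only [ih, Finset.mul_sum]
      rw [Finset.sum_comm]
      refine Finset.sum_congr rfl fun y _ => ?_
      rw [Matrix.det_succ_column_zero]
      refine Finset.sum_congr rfl fun j _ => ?_
      rw [seqDual_single, one_mul]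
      rfl

/-- The linear part of the action of `seqDual f` on `wedgeSum M`. -/
noncomputable def contractVec (f : ℤ → ℝ) (M : ℕ) : ℤ →₀ ℝ :=
  -∑ y ∈ Finset.range M, Finsupp.single (y + 1 : ℤ)
    (2 * ∑ x ∈ Finset.range y, f (x + 1) + f (y + 1))

/-- Write Ω for `wedgeSum M`, e for the new basis vector, φ for the value of `f` there, and let
contraction act on Ω as c + b. Since e² = 0 and eb = -be, contracting (1+e)Ω gives (c + φ + b -
(2c+φ)e)(1+e)Ω. So the scalar grows by φ and the vector by -(2c+φ)e, which is the recursion behind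
`contractVec`. -/
theorem contractLeft_wedgeSum (f : ℤ → ℝ) (M : ℕ) :
    CliffordAlgebra.contractLeft (seqDual f) (wedgeSum M) =
      (∑ y ∈ Finset.range M, f (y + 1)) • wedgeSum M +
        ExteriorAlgebra.ι ℝ (contractVec f M) * wedgeSum M := by
  induction M with
  | zero =>
    have : CliffordAlgebra.contractLeft (seqDual f) (1 : ExteriorAlgebra ℝ (ℤ →₀ ℝ)) = 0 :=
      CliffordAlgebra.contractLeft_one (Q := 0) (seqDual f)
    simp [wedgeSum, contractVec, this]
  | succ M ih =>
    have hb : contractVec f (M + 1) = contractVec f M -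
        (2 * ∑ x ∈ Finset.range M, f (x + 1) + f (M + 1)) • Finsupp.single (M + 1 : ℤ) 1 := by
      simp [contractVec, Finset.sum_range_succ, sub_eq_add_neg, add_comm]
    rw [wedgeSum, map_add, contractLeft_ι_mul_exterior, ih, seqDual_single, hb,
      Finset.sum_range_succ]
    set c := ∑ x ∈ Finset.range M, f (x + 1)
    set e := ExteriorAlgebra.ι ℝ (Finsupp.single (M + 1 : ℤ) (1 : ℝ)) with he
    set b := ExteriorAlgebra.ι ℝ (contractVec f M) with hb'
    set φ := f (M + 1)
    have h1 : e * e = 0 := ExteriorAlgebra.ι_sq_zero _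
    have h2 : e * b = -(b * e) := eq_neg_of_add_eq_zero_left (ExteriorAlgebra.ι_add_mul_swap _ _)
    rw [map_sub, map_smul, ← he, ← hb']
    have h3 : ∀ X, e * (e * X) = 0 := fun X => by rw [← mul_assoc, h1, zero_mul]
    have h4 : ∀ X, e * (b * X) = -(b * (e * X)) := fun X => by
      rw [← mul_assoc, h2, neg_mul, mul_assoc]
    simp only [mul_add, add_mul, sub_mul, smul_mul_assoc, mul_smul_comm, h3, h4, smul_zero, add_smul,
      smul_add, mul_smul, one_mul, two_smul]
    abel

/-! ### A projective Cauchy determinant -/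

theorem det_eq_of_forall_col_eq_smul_add_const {n : ℕ} {A B : Matrix (Fin n) (Fin n) ℝ}
    (c : Fin n → ℝ) (k : Fin n) (hk : c k = 0) (h : ∀ i j, A i j = B i j + c j * B i k) :
    A.det = B.det := by
  rw [← Matrix.det_transpose, ← Matrix.det_transpose B]
  exact Matrix.det_eq_of_forall_row_eq_smul_add_const c k hk fun i j => h j i

/-- Cauchy's determinant with the points (x_i : w_i) taken on the projective line. The point at
infinity, w_i = 0, gives a constant row, which is needed when there is one odd mode more than even
ones. -/
theorem det_projCauchy (n : ℕ) (x w y : Fin n → ℝ) (h : ∀ i j, x i - w i * y j ≠ 0) :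
    (Matrix.of fun i j => 1 / (x i - w i * y j)).det =
      (∏ i, ∏ j ∈ Finset.Ioi i, (w j * x i - w i * x j)) *
        (∏ i, ∏ j ∈ Finset.Ioi i, (y j - y i)) / ∏ i, ∏ j, (x i - w i * y j) := by
  induction n with
  | zero => simp
  | succ n ih =>
    -- Subtracting column 0 leaves w_i (y_j - y_0) / ((x_i - w_i y_0)(x_i - w_i y_j)). Here `v`
    -- collects the column factors and `B` what remains once the row factors 1/(x_i - w_i y_0) are
    -- removed. Subtracting row 0, whose entries are `u`, then gives `C`, which is again of Cauchy
    -- type up to row and column factors.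
    let v : Fin (n + 1) → ℝ := Fin.cons 1 fun j => y j.succ - y 0
    let B : Matrix (Fin (n + 1)) (Fin (n + 1)) ℝ := Matrix.of fun i =>
      (Fin.cons 1 fun j : Fin n => w i / (x i - w i * y j.succ) : Fin (n + 1) → ℝ)
    let u : Fin (n + 1) → ℝ := Fin.cons 1 fun j => w 0 / (x 0 - w 0 * y j.succ)
    let C : Matrix (Fin (n + 1)) (Fin (n + 1)) ℝ := Matrix.of
      (Fin.cons u fun i j => B i.succ j - u j : Fin (n + 1) → Fin (n + 1) → ℝ)
    have h1 : (Matrix.of fun i j => 1 / (x i - w i * y j)).det =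
        (Matrix.of fun i j => 1 / (x i - w i * y 0) * (Matrix.of fun i j => v j * B i j) i j).det := by
      refine det_eq_of_forall_col_eq_smul_add_const
        (Fin.cons 0 fun _ : Fin n => 1 : Fin (n + 1) → ℝ) 0 rfl fun i j => ?_
      induction j using Fin.cases with
      | zero => simp [v, B]
      | succ j =>
        have := h i 0
        have := h i j.succ
        simp only [v, B, Matrix.of_apply, Fin.cons_succ, Fin.cons_zero]
        field_simp
        ring
    have h2 : B.det = C.det := by
      refine Matrix.det_eq_of_forall_row_eq_smul_add_const
        (Fin.cons 0 fun _ : Fin n => 1 : Fin (n + 1) → ℝ) 0 rfl fun i j => ?_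
      induction i using Fin.cases with
      | zero => induction j using Fin.cases <;> simp [B, C, u]
      | succ i => simp [C]
    have h3 : C.submatrix (Fin.succAbove 0) Fin.succ =
          Matrix.of fun i j => (w i.succ * x 0 - w 0 * x i.succ) *
            (Matrix.of fun i j => (1 / (x 0 - w 0 * y (Fin.succ j))) *
              (Matrix.of fun i j => 1 / (x (Fin.succ i) - w i.succ * y (Fin.succ j))) i j) i j := by
      ext i j
      have := h 0 j.succ
      have := h i.succ j.succ
      simp only [C, B, u, Matrix.submatrix_apply, Matrix.of_apply, Fin.zero_succAbove, Fin.cons_succ]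
      rw [div_sub_div _ _ (by assumption) (by assumption), div_mul_div_comm, mul_div_assoc',
        mul_comm (x i.succ - _)]
      ring
    have h4 : ∀ i : Fin n, C i.succ 0 = 0 := fun i => by simp [C, B, u]
    rw [h1, Matrix.det_mul_column, Matrix.det_mul_row, h2, Matrix.det_succ_column_zero,
      Fin.sum_univ_succ, Finset.sum_eq_zero (s := Finset.univ (α := Fin n)) (by simp [h4]),
      add_zero, h3, Matrix.det_mul_column, Matrix.det_mul_row,
      ih (fun i => x i.succ) (fun i => w i.succ) (fun i => y i.succ) fun i j => h _ _]
    simp only [Fin.prod_univ_succ, Fin.prod_Ioi_zero, Fin.prod_Ioi_succ, Finset.prod_div_distrib,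
      Finset.prod_mul_distrib, Finset.prod_const_one, v]
    have a1 : x 0 - w 0 * y 0 ≠ 0 := h _ _
    have a2 : ∏ i : Fin n, (x i.succ - w i.succ * y 0) ≠ 0 :=
      Finset.prod_ne_zero_iff.2 fun i _ => h _ _
    have a3 : ∏ i : Fin n, (x 0 - w 0 * y i.succ) ≠ 0 := Finset.prod_ne_zero_iff.2 fun i _ => h _ _
    have a4 : ∏ i : Fin n, ∏ j : Fin n, (x i.succ - w i.succ * y j.succ) ≠ 0 :=
      Finset.prod_ne_zero_iff.2 fun i _ => Finset.prod_ne_zero_iff.2 fun j _ => h _ _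
    rw [show C 0 0 = 1 from rfl]
    simp only [Fin.cons_succ, Fin.cons_zero, Fin.val_zero, pow_zero]
    generalize ∏ i : Fin n, ∏ j : Fin n, (x i.succ - w i.succ * y j.succ) = b4 at *
    generalize ∏ i : Fin n, (x 0 - w 0 * y i.succ) = b3 at *
    generalize ∏ i : Fin n, (x i.succ - w i.succ * y 0) = b2 at *
    generalize x 0 - w 0 * y 0 = b1 at *
    field_simp
    simp only [mul_comm (x 0)]
    ring

/-! ### Sine modes -/

/-- The eigenvector of index `r` of a path with the vertices `1, …, m - 1`. -/
noncomputable def sineMode (m : ℕ) (r x : ℤ) : ℝ := Real.sin (r * x * Real.pi / m)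

/-- The cosine belonging to the mode `r`. -/
noncomputable def modeCos (m : ℕ) (r : ℤ) : ℝ := Real.cos (r * Real.pi / m)

open Classical in
/-- The factor contributed by a single mode to a sum of determinants. -/
noncomputable def modeWeight (m : ℕ) (r : ℤ) : ℝ :=
  if Even r then Real.sin (r * Real.pi / m)
  else Real.cos (r * Real.pi / (2 * m)) / Real.sin (r * Real.pi / (2 * m))

open Classical in
/-- The factor contributed by a pair of modes to a sum of determinants. -/
noncomputable def modePair (m : ℕ) (r s : ℤ) : ℝ :=
  if Even (r - s) then modeCos m r - modeCos m s else 1 / (modeCos m r - modeCos m s)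

/-- Twice the partial sum plus the next term is the coefficient in `contractVec`; this combination
telescopes to a single factor 1 - cos. -/
theorem sin_mul_partial_sum_sin (a : ℝ) (y : ℕ) :
    Real.sin a * (2 * ∑ x ∈ Finset.range y, Real.sin (2 * a * (x + 1)) +
      Real.sin (2 * a * (y + 1))) = Real.cos a * (1 - Real.cos (2 * a * (y + 1))) := by
  induction y with
  | zero =>
    simp only [Finset.range_zero, Finset.sum_empty, mul_zero, zero_add, Nat.cast_zero, mul_one,
      Real.sin_two_mul, Real.cos_two_mul]
    linear_combination (2 * Real.cos a) * Real.sin_sq_add_cos_sq a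
  | succ y ih =>
    rw [Finset.sum_range_succ]
    have h1 : 2 * a * ((y : ℝ) + 1) = (2 * y + 3) * a - a := by ring
    have h2 : 2 * a * (((y + 1 : ℕ) : ℝ) + 1) = (2 * y + 3) * a + a := by push_cast; ring
    rw [h2]
    rw [h1] at ih ⊢
    simp only [Real.sin_add, Real.cos_add, Real.sin_sub, Real.cos_sub] at ih ⊢
    linear_combination ih

theorem cos_int_mul_pi_of_even {r : ℤ} (h : Even r) : Real.cos (r * Real.pi) = 1 := by
  obtain ⟨k, rfl⟩ := h
  rw [← Real.cos_int_mul_two_pi k]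
  push_cast
  ring_nf

theorem cos_int_mul_pi_of_odd {r : ℤ} (h : Odd r) : Real.cos (r * Real.pi) = -1 := by
  obtain ⟨k, rfl⟩ := h
  have := Real.cos_int_mul_two_pi_add_pi k
  rw [← this]
  push_cast
  ring_nf

theorem sin_ne_zero_of_odd {m : ℕ} (hm : 0 < m) {r : ℤ} (h : Odd r) :
    Real.sin (r * Real.pi / (2 * m)) ≠ 0 := by
  have hm' : (m : ℝ) ≠ 0 := by positivity
  rw [Real.sin_ne_zero_iff]
  intro k hk
  have hpi := Real.pi_ne_zero
  field_simp at hk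
  have : (k * 2 * m : ℤ) = r := by exact_mod_cast hk
  rw [← this] at h
  exact absurd h (by rw [Int.not_odd_iff_even]; exact ⟨k * m, by ring⟩)

theorem sin_pos_of_lt {m : ℕ} {r : ℤ} (h0 : 0 < r) (h1 : r < 2 * m) :
    0 < Real.sin (r * Real.pi / (2 * m)) := by
  have h0' : (0 : ℝ) < r := by exact_mod_cast h0
  have h1' : (r : ℝ) < 2 * m := by exact_mod_cast h1
  apply Real.sin_pos_of_pos_of_lt_pi
  · have := Real.pi_pos
    have : (0 : ℝ) < 2 * m := h0'.trans h1'
    positivity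
  · rw [div_lt_iff₀ (h0'.trans h1'), mul_comm]
    exact mul_lt_mul_of_pos_left h1' Real.pi_pos

theorem two_mul_sin_mul_sum_sineMode {m : ℕ} (hm : 0 < m) (r : ℤ) :
    2 * Real.sin (r * Real.pi / (2 * m)) *
      ∑ y ∈ Finset.range (m - 1), sineMode m r (y + 1) =
      Real.cos (r * Real.pi / (2 * m)) * (1 - Real.cos (r * Real.pi)) := by
  have hm' : (m : ℝ) ≠ 0 := by positivity
  have h := sin_mul_partial_sum_sin (r * Real.pi / (2 * m)) (m - 1)
  have h1 : 2 * (r * Real.pi / (2 * m)) * (((m - 1 : ℕ) : ℝ) + 1) = r * Real.pi := by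
    rw [Nat.cast_sub hm]
    push_cast
    field_simp
    ring
  rw [h1, Real.sin_int_mul_pi, add_zero] at h
  rw [← h]
  have : ∀ y : ℕ, sineMode m r (y + 1) = Real.sin (2 * (r * Real.pi / (2 * m)) * (y + 1)) := by
    intro y
    rw [sineMode]
    congr 1
    push_cast
    field_simp
  simp only [this]
  ring

theorem sum_sineMode_of_odd {m : ℕ} (hm : 0 < m) {r : ℤ} (hr : Odd r) :
    ∑ y ∈ Finset.range (m - 1), sineMode m r (y + 1) =
      Real.cos (r * Real.pi / (2 * m)) / Real.sin (r * Real.pi / (2 * m)) := by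
  have h := two_mul_sin_mul_sum_sineMode hm r
  rw [cos_int_mul_pi_of_odd hr] at h
  rw [eq_div_iff (sin_ne_zero_of_odd hm hr)]
  linarith

/-- The reflection x ↦ m - x changes the sign of an even mode. Hence contraction by an even mode
multiplies `wedgeSum` by a vector alone. -/
theorem sum_sineMode_of_even {m : ℕ} (hm : 0 < m) {r : ℤ} (hr : Even r) :
    ∑ y ∈ Finset.range (m - 1), sineMode m r (y + 1) = 0 := by
  have h2 : ∀ y ∈ Finset.range (m - 1), sineMode m r (((m - 1 - 1 - y : ℕ) : ℤ) + 1) =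
      -sineMode m r (y + 1) := by
    intro y hy
    rw [Finset.mem_range] at hy
    have hm' : (m : ℝ) ≠ 0 := by positivity
    have : (((m - 1 - 1 - y : ℕ) : ℤ) + 1) = m - (y + 1) := by omega
    obtain ⟨k, rfl⟩ := hr
    rw [this, sineMode, sineMode, ← Real.sin_neg, ← Real.sin_add_int_mul_two_pi _ (-k)]
    congr 1
    push_cast
    field_simp
    ring
  have h := Finset.sum_range_reflect (fun y : ℕ => sineMode m r (y + 1)) (m - 1)
  rw [Finset.sum_congr rfl h2, Finset.sum_neg_distrib] at h
  linarith

theorem sineMode_mul_cos (m : ℕ) (r s x : ℤ) :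
    sineMode m r x * Real.cos (s * x * Real.pi / m) =
      (sineMode m (r + s) x + sineMode m (r - s) x) / 2 := by
  rw [sineMode, sineMode, sineMode]
  have h1 : ((r + s : ℤ) : ℝ) * x * Real.pi / m = r * x * Real.pi / m + s * x * Real.pi / m := by
    push_cast; ring
  have h2 : ((r - s : ℤ) : ℝ) * x * Real.pi / m = r * x * Real.pi / m - s * x * Real.pi / m := by
    push_cast; ring
  rw [h1, h2, Real.sin_add, Real.sin_sub]
  ring

theorem modeCos_sub (m : ℕ) (r s : ℤ) : modeCos m r - modeCos m s =
    2 * Real.sin ((s + r : ℤ) * Real.pi / (2 * m)) * Real.sin ((s - r : ℤ) * Real.pi / (2 * m)) := by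
  rw [modeCos, modeCos, Real.cos_sub_cos]
  have h1 : (r * Real.pi / m + s * Real.pi / m) / 2 = (s + r : ℤ) * Real.pi / (2 * m) := by
    push_cast; ring
  have h2 : (r * Real.pi / m - s * Real.pi / m) / 2 = -((s - r : ℤ) * Real.pi / (2 * m)) := by
    push_cast; ring
  rw [h1, h2, Real.sin_neg]
  ring

theorem modeCos_sub_ne_zero {m : ℕ} (hm : 0 < m) {e o : ℤ} (he : Even e) (ho : Odd o) :
    modeCos m e - modeCos m o ≠ 0 := by
  rw [modeCos_sub]
  exact mul_ne_zero (mul_ne_zero two_ne_zero (sin_ne_zero_of_odd hm (ho.add_even he)))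
    (sin_ne_zero_of_odd hm (ho.sub_even he))

theorem contractVec_sineMode {m : ℕ} (e : ℤ) (h : Real.sin (e * Real.pi / (2 * m)) ≠ 0) (M : ℕ) :
    contractVec (sineMode m e) M = -∑ y ∈ Finset.range M, Finsupp.single (y + 1 : ℤ)
      (Real.cos (e * Real.pi / (2 * m)) / Real.sin (e * Real.pi / (2 * m)) *
        (1 - Real.cos (e * ((y : ℤ) + 1 : ℤ) * Real.pi / m))) := by
  rw [contractVec]
  congr 1
  refine Finset.sum_congr rfl fun y _ => ?_
  congr 1
  rw [div_mul_eq_mul_div, eq_div_iff h]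
  have := sin_mul_partial_sum_sin (e * Real.pi / (2 * m)) y
  have h1 : ∀ y : ℕ, 2 * (e * Real.pi / (2 * m)) * ((y : ℝ) + 1) =
      e * (((y : ℤ) + 1 : ℤ) : ℝ) * Real.pi / m := by
    intro y
    push_cast
    ring
  simp only [h1] at this
  rw [← this, mul_comm]
  rfl

/-- The coefficients of the vector are multiples of 1 - cos, so pairing with mode `r` produces the
full sums of the modes r and r ± e only, and these are governed by parity. -/
theorem seqDual_contractVec_sineMode {m : ℕ} (r e : ℤ)
    (h : Real.sin (e * Real.pi / (2 * m)) ≠ 0) :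
    seqDual (sineMode m r) (contractVec (sineMode m e) (m - 1)) =
      -(Real.cos (e * Real.pi / (2 * m)) / Real.sin (e * Real.pi / (2 * m)) *
        ((∑ y ∈ Finset.range (m - 1), sineMode m r (y + 1)) -
          ((∑ y ∈ Finset.range (m - 1), sineMode m (r + e) (y + 1)) +
            (∑ y ∈ Finset.range (m - 1), sineMode m (r - e) (y + 1))) / 2)) := by
  rw [contractVec_sineMode e h, map_neg, map_sum]
  simp only [seqDual_single]
  rw [← Finset.sum_add_distrib, Finset.sum_div, ← Finset.sum_sub_distrib, Finset.mul_sum]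
  congr 1
  refine Finset.sum_congr rfl fun y _ => ?_
  rw [← sineMode_mul_cos]
  ring

theorem seqDual_contractVec_of_even {m : ℕ} (hm : 0 < m) {r e : ℤ} (hr : Even r) (he : Even e)
    (h : Real.sin (e * Real.pi / (2 * m)) ≠ 0) :
    seqDual (sineMode m r) (contractVec (sineMode m e) (m - 1)) = 0 := by
  rw [seqDual_contractVec_sineMode r e h, sum_sineMode_of_even hm hr,
    sum_sineMode_of_even hm (hr.add he), sum_sineMode_of_even hm (hr.sub he)]
  simp

/-- With half angles a of `r` and b of `e`, the three cotangents combine through sin(a+b) sin(a-b) =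
sin²a - sin²b, half the difference of the two cosines. This is where the Cauchy kernel comes from.
-/
theorem seqDual_contractVec_of_odd {m : ℕ} (hm : 0 < m) {r e : ℤ} (hr : Odd r) (he : Even e)
    (h : Real.sin (e * Real.pi / (2 * m)) ≠ 0) :
    seqDual (sineMode m r) (contractVec (sineMode m e) (m - 1)) =
      modeWeight m e * (modeWeight m r * (1 / (modeCos m e - modeCos m r))) := by
  have h1 := sin_ne_zero_of_odd hm (hr.add_even he)
  have h2 := sin_ne_zero_of_odd hm (hr.sub_even he)
  have h3 := sin_ne_zero_of_odd hm hr
  rw [seqDual_contractVec_sineMode r e h, sum_sineMode_of_odd hm hr,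
    sum_sineMode_of_odd hm (hr.add_even he), sum_sineMode_of_odd hm (hr.sub_even he),
    modeCos_sub, modeWeight, if_pos he, modeWeight, if_neg (Int.not_even_iff_odd.2 hr)]
  have e1 : ((r + e : ℤ) : ℝ) * Real.pi / (2 * m) = r * Real.pi / (2 * m) + e * Real.pi / (2 * m) := by
    push_cast; ring
  have e2 : ((r - e : ℤ) : ℝ) * Real.pi / (2 * m) = r * Real.pi / (2 * m) - e * Real.pi / (2 * m) := by
    push_cast; ring
  have e3 : (e : ℝ) * Real.pi / m = 2 * (e * Real.pi / (2 * m)) := by ring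
  rw [e1] at h1
  rw [e2] at h2
  rw [e1, e2, e3]
  generalize (r : ℝ) * Real.pi / (2 * m) = a at *
  generalize (e : ℝ) * Real.pi / (2 * m) = b at *
  have key : Real.cos (a + b) / Real.sin (a + b) + Real.cos (a - b) / Real.sin (a - b) =
      2 * Real.sin a * Real.cos a / (Real.sin (a + b) * Real.sin (a - b)) := by
    rw [div_add_div _ _ h1 h2, ← Real.sin_two_mul, show 2 * a = (a + b) + (a - b) by ring,
      Real.sin_add (a + b)]
    ring
  have key2 : Real.sin (a + b) * Real.sin (a - b) = Real.sin a ^ 2 - Real.sin b ^ 2 := by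
    rw [Real.sin_add, Real.sin_sub]
    linear_combination Real.sin a ^ 2 * Real.sin_sq_add_cos_sq b - Real.sin b ^ 2 * Real.sin_sq_add_cos_sq a
  have key3 : Real.sin a ^ 2 - Real.sin b ^ 2 ≠ 0 := by rw [← key2]; exact mul_ne_zero h1 h2
  rw [key, mul_assoc 2 (Real.sin (a + b)), key2, Real.sin_two_mul]
  field_simp
  ring

/-! ### Product formula for the sums of determinants of modes -/

theorem prod_Ioi_eq_prod_ite {n : ℕ} (i : Fin n) (F : Fin n → ℝ) :
    ∏ j ∈ Finset.Ioi i, F j = ∏ j, if i < j then F j else 1 := by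
  rw [← Finset.filter_lt_eq_Ioi, Finset.prod_filter]

theorem prod_prod_Ioi_add {p k : ℕ} (F : Fin (p + k) → Fin (p + k) → ℝ) :
    ∏ i, ∏ j ∈ Finset.Ioi i, F i j =
      (∏ i : Fin p, ∏ j ∈ Finset.Ioi i, F (Fin.castAdd k i) (Fin.castAdd k j)) *
      (∏ i : Fin p, ∏ j : Fin k, F (Fin.castAdd k i) (Fin.natAdd p j)) *
      ∏ i : Fin k, ∏ j ∈ Finset.Ioi i, F (Fin.natAdd p i) (Fin.natAdd p j) := by
  have h1 : ∀ (i : Fin p) (j : Fin k), Fin.castAdd k i < Fin.natAdd p j := fun i j => by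
    rw [Fin.lt_def]; simp; omega
  have h2 : ∀ (i : Fin p) (j : Fin k), ¬ Fin.natAdd p j < Fin.castAdd k i := fun i j => by
    rw [Fin.lt_def]; simp; omega
  have h3 : ∀ i j : Fin p, Fin.castAdd k i < Fin.castAdd k j ↔ i < j := fun i j => by
    simp only [Fin.lt_def, Fin.val_castAdd]
  have h4 : ∀ i j : Fin k, Fin.natAdd p i < Fin.natAdd p j ↔ i < j := fun i j => by
    simp only [Fin.lt_def, Fin.val_natAdd]; omega
  simp only [prod_Ioi_eq_prod_ite, Fin.prod_univ_add, h1, h2, h3, h4, if_true, if_false,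
    Finset.prod_const_one, Finset.prod_mul_distrib]
  ring

theorem exists_prod_prod_Ioi_sub_comm (n : ℕ) : ∃ K : ℝ, K ^ 2 = 1 ∧ ∀ y : Fin n → ℝ,
    ∏ i, ∏ j ∈ Finset.Ioi i, (y j - y i) = K * ∏ i, ∏ j ∈ Finset.Ioi i, (y i - y j) := by
  refine ⟨∏ i : Fin n, ∏ j ∈ Finset.Ioi i, (-1), ?_, fun y => ?_⟩
  · simp [← Finset.prod_pow, ← pow_mul, pow_mul']
  · simp only [← Finset.prod_mul_distrib]
    refine Finset.prod_congr rfl fun i _ => Finset.prod_congr rfl fun j _ => by ring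

theorem sq_prod_neg_one_pow (p : ℕ) : (∏ i ∈ Finset.range p, (-1 : ℝ) ^ i) ^ 2 = 1 := by
  simp [← Finset.prod_pow, ← pow_mul, pow_mul']

/-- The sum of the determinants of the modes `r` over all points of the alcove. -/
noncomputable def modeSum {n : ℕ} (m : ℕ) (r : Fin n → ℤ) : ℝ :=
  ∑ x ∈ strictAntiSeqs n (m - 1), (Matrix.of fun i j => sineMode m (r i) (x j)).det

theorem modeSum_comp_perm {n : ℕ} (m : ℕ) (r : Fin n → ℤ) (σ : Equiv.Perm (Fin n)) :
    modeSum m (fun i => r (σ i)) = (σ.sign : ℤ) * modeSum m r := by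
  rw [modeSum, modeSum, Finset.mul_sum]
  exact Finset.sum_congr rfl fun x _ =>
    Matrix.det_permute σ (Matrix.of fun i j => sineMode m (r i) (x j))

theorem modePair_swap (m : ℕ) (r s : ℤ) : modePair m r s = -modePair m s r := by
  rw [modePair, modePair]
  have : Even (r - s) ↔ Even (s - r) := by rw [← even_neg, neg_sub]
  by_cases h : Even (r - s)
  · rw [if_pos h, if_pos (this.1 h)]; ring
  · rw [if_neg h, if_neg (mt this.2 h), ← neg_sub (modeCos m s), one_div, one_div, inv_neg]

theorem prod_modePair_comp_perm {n : ℕ} (m : ℕ) (r : Fin n → ℤ) (σ : Equiv.Perm (Fin n)) :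
    ∏ i, ∏ j ∈ Finset.Ioi i, modePair m (r (σ i)) (r (σ j)) =
      (σ.sign : ℤ) * ∏ i, ∏ j ∈ Finset.Ioi i, modePair m (r i) (r j) :=
  σ.prod_Ioi_comp_eq_sign_mul_prod (f := fun i j => modePair m (r i) (r j))
    fun _ _ => modePair_swap _ _ _

theorem modeSum_append {p k m : ℕ} (r : Fin (p + k) → ℤ) :
    modeSum m r = contractScalar k (fun j => seqDual (sineMode m (r (Fin.natAdd p j))))
      (iterContract p (fun i => seqDual (sineMode m (r (Fin.castAdd k i)))) (wedgeSum (m - 1))) := by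
  rw [modeSum, ← contractScalar_wedgeSum, contractScalar, iterContract_append, contractScalar]

theorem contractLeft_sineMode_of_even {m : ℕ} (hm : 0 < m) {e : ℤ} (he : Even e) :
    CliffordAlgebra.contractLeft (seqDual (sineMode m e)) (wedgeSum (m - 1)) =
      ExteriorAlgebra.ι ℝ (contractVec (sineMode m e) (m - 1)) * wedgeSum (m - 1) := by
  rw [contractLeft_wedgeSum, sum_sineMode_of_even hm he, zero_smul, zero_add]

theorem contractScalar_one_sineMode {m : ℕ} (hm : 0 < m) {o : ℤ} (ho : Odd o) :
    contractScalar 1 (fun _ => seqDual (sineMode m o)) (wedgeSum (m - 1)) = modeWeight m o := by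
  rw [contractScalar, iterContract, iterContract, contractLeft_wedgeSum, sum_sineMode_of_odd hm ho,
    modeWeight, if_neg (Int.not_even_iff_odd.2 ho), map_add, map_smul, algebraMapInv_wedgeSum]
  simp [ExteriorAlgebra.algebraMapInv]

section Sorted

variable {p k m : ℕ}

theorem prod_prod_modePair_sorted (r : Fin (p + k) → ℤ)
    (he : ∀ i, Even (r (Fin.castAdd k i))) (ho : ∀ j, Odd (r (Fin.natAdd p j))) :
    ∏ i, ∏ j ∈ Finset.Ioi i, modePair m (r i) (r j) =
      (∏ i : Fin p, ∏ j ∈ Finset.Ioi i,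
        (modeCos m (r (Fin.castAdd k i)) - modeCos m (r (Fin.castAdd k j)))) *
      (∏ i : Fin p, ∏ j : Fin k,
        (1 / (modeCos m (r (Fin.castAdd k i)) - modeCos m (r (Fin.natAdd p j))))) *
      ∏ i : Fin k, ∏ j ∈ Finset.Ioi i,
        (modeCos m (r (Fin.natAdd p i)) - modeCos m (r (Fin.natAdd p j))) := by
  rw [prod_prod_Ioi_add]
  have h1 : ∀ i j, modePair m (r (Fin.castAdd k i)) (r (Fin.castAdd k j)) =
      modeCos m (r (Fin.castAdd k i)) - modeCos m (r (Fin.castAdd k j)) := fun i j => by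
    rw [modePair, if_pos ((he i).sub (he j))]
  have h2 : ∀ i j, modePair m (r (Fin.castAdd k i)) (r (Fin.natAdd p j)) =
      1 / (modeCos m (r (Fin.castAdd k i)) - modeCos m (r (Fin.natAdd p j))) := fun i j => by
    rw [modePair, if_neg (Int.not_even_iff_odd.2 ((he i).sub_odd (ho j)))]
  have h3 : ∀ i j, modePair m (r (Fin.natAdd p i)) (r (Fin.natAdd p j)) =
      modeCos m (r (Fin.natAdd p i)) - modeCos m (r (Fin.natAdd p j)) := fun i j => by
    rw [modePair, if_pos ((ho i).sub_odd (ho j))]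
  simp only [h1, h2, h3]

/-- The even modes, contracted first, turn into vectors, and the odd modes evaluate on these as a
Cauchy matrix scaled by the weights. Only the independence of the sign `K` from the modes is
recorded; its value follows later from positivity. -/
theorem exists_modeSum_sorted_eq (hk : k = p ∨ k = p + 1) (hm : 0 < m) : ∃ K : ℝ, K ^ 2 = 1 ∧
    ∀ r : Fin (p + k) → ℤ, (∀ i, 0 < r i ∧ r i < 2 * m) →
      (∀ i, Even (r (Fin.castAdd k i))) → (∀ j, Odd (r (Fin.natAdd p j))) →
      modeSum m r = K * (∏ i, modeWeight m (r i)) *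
        ∏ i, ∏ j ∈ Finset.Ioi i, modePair m (r i) (r j) := by
  obtain ⟨K, hK, hKy⟩ := exists_prod_prod_Ioi_sub_comm k
  rcases hk with rfl | rfl
  · refine ⟨(∏ i ∈ Finset.range k, (-1 : ℝ) ^ i) * K, by
      rw [mul_pow, sq_prod_neg_one_pow, hK, one_mul], fun r hr he ho => ?_⟩
    have hs := fun i => (sin_pos_of_lt (hr i).1 (hr i).2).ne'
    rw [modeSum_append, contractScalar_eq_det _ _
      (fun i => contractVec (sineMode m (r (Fin.castAdd k i))) (m - 1)) _
      (fun i => contractLeft_sineMode_of_even hm (he i))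
      (fun i j => seqDual_contractVec_of_even hm (he i) (he j) (hs _)),
      algebraMapInv_wedgeSum, prod_prod_modePair_sorted r he ho]
    have h : (Matrix.of fun i j : Fin k => seqDual (sineMode m (r (Fin.natAdd k j)))
        (contractVec (sineMode m (r (Fin.castAdd k i))) (m - 1))) =
        Matrix.of fun i j => modeWeight m (r (Fin.castAdd k i)) *
          (Matrix.of fun i j => modeWeight m (r (Fin.natAdd k j)) * (Matrix.of fun i j =>
            1 / (modeCos m (r (Fin.castAdd k i)) - 1 * modeCos m (r (Fin.natAdd k j)))) i j) i j := by
      ext i j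
      simp only [Matrix.of_apply, one_mul]
      exact seqDual_contractVec_of_odd hm (ho j) (he i) (hs _)
    rw [h, Matrix.det_mul_column, Matrix.det_mul_row, det_projCauchy k
      (fun i => modeCos m (r (Fin.castAdd k i))) (fun _ => 1)
      (fun j => modeCos m (r (Fin.natAdd k j))) (fun i j => by
        rw [one_mul]; exact modeCos_sub_ne_zero hm (he i) (ho j)), hKy, Fin.prod_univ_add]
    simp only [one_mul, Finset.prod_div_distrib, Finset.prod_const_one]
    ring
  · refine ⟨(∏ i ∈ Finset.range p, (-1 : ℝ) ^ i) * K * (-1) ^ p, by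
      rw [mul_pow, mul_pow, sq_prod_neg_one_pow, hK, ← pow_mul, mul_comm p, pow_mul]; simp,
      fun r hr he ho => ?_⟩
    have hs := fun i => (sin_pos_of_lt (hr i).1 (hr i).2).ne'
    rw [modeSum_append, contractScalar_eq_det_snoc _ _
      (fun i => contractVec (sineMode m (r (Fin.castAdd (p + 1) i))) (m - 1)) _
      (fun i => contractLeft_sineMode_of_even hm (he i))
      (fun i j => seqDual_contractVec_of_even hm (he i) (he j) (hs _)),
      prod_prod_modePair_sorted r he ho]
    -- The extra row consists of the weights of the odd modes alone. It is the Cauchy row of the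
    -- point at infinity, as 1/(1 - 0·y) = 1.
    let x : Fin (p + 1) → ℝ := Fin.snoc (fun i => modeCos m (r (Fin.castAdd (p + 1) i))) 1
    let w : Fin (p + 1) → ℝ := Fin.snoc (fun _ => 1) 0
    let v : Fin (p + 1) → ℝ := Fin.snoc (fun i => modeWeight m (r (Fin.castAdd (p + 1) i))) 1
    let y : Fin (p + 1) → ℝ := fun j => modeCos m (r (Fin.natAdd p j))
    have x1 : x (Fin.last p) = 1 := Fin.snoc_last _ _
    have w1 : w (Fin.last p) = 0 := Fin.snoc_last _ _
    have v1 : v (Fin.last p) = 1 := Fin.snoc_last _ _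
    have x2 : ∀ i : Fin p, x i.castSucc = modeCos m (r (Fin.castAdd (p + 1) i)) := fun i =>
      Fin.snoc_castSucc _ _ _
    have w2 : ∀ i : Fin p, w i.castSucc = 1 := fun i => Fin.snoc_castSucc _ _ _
    have v2 : ∀ i : Fin p, v i.castSucc = modeWeight m (r (Fin.castAdd (p + 1) i)) := fun i =>
      Fin.snoc_castSucc _ _ _
    have h : (Matrix.of fun i j : Fin (p + 1) => (Fin.snoc (α := fun _ => ℝ)
        (fun i => seqDual (sineMode m (r (Fin.natAdd p j)))
          (contractVec (sineMode m (r (Fin.castAdd (p + 1) i))) (m - 1)))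
        (contractScalar 1 (fun _ => seqDual (sineMode m (r (Fin.natAdd p j))))
          (wedgeSum (m - 1))) i)) =
        Matrix.of fun i j => v i *
          (Matrix.of fun i j => modeWeight m (r (Fin.natAdd p j)) * (Matrix.of fun i j =>
            1 / (x i - w i * y j)) i j) i j := by
      ext i j
      simp only [Matrix.of_apply]
      induction i using Fin.lastCases with
      | last =>
        rw [Fin.snoc_last, contractScalar_one_sineMode hm (ho j), x1, w1, v1]
        simp
      | cast i =>
        rw [Fin.snoc_castSucc, x2, w2, v2, one_mul]
        exact seqDual_contractVec_of_odd hm (ho j) (he i) (hs _)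
    rw [h, Matrix.det_mul_column, Matrix.det_mul_row, det_projCauchy (p + 1) x w y (fun i j => by
      induction i using Fin.lastCases with
      | last => rw [x1, w1]; simp
      | cast i => rw [x2, w2, one_mul]; exact modeCos_sub_ne_zero hm (he i) (ho j)), hKy,
      Fin.prod_univ_add fun i => modeWeight m (r i)]
    -- Each of the `p` finite points contributes 0·x_i - 1·1 = -1 when paired with the point at
    -- infinity.
    have h5 : ∏ i, ∏ j ∈ Finset.Ioi i, (w j * x i - w i * x j) = (-1) ^ p *
        ∏ i : Fin p, ∏ j ∈ Finset.Ioi i,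
        (modeCos m (r (Fin.castAdd (p + 1) i)) - modeCos m (r (Fin.castAdd (p + 1) j))) := by
      rw [prod_prod_Ioi_add (p := p) (k := 1)]
      have e1 : ∀ i : Fin 1, Fin.natAdd p i = Fin.last p := fun i => by
        rw [Fin.fin_one_eq_zero i]; rfl
      have e2 : ∀ i : Fin p, Fin.castAdd 1 i = i.castSucc := fun i => rfl
      simp only [e1, e2, x1, x2, w1, w2]
      simp [mul_comm]
    have h6 : ∏ i, ∏ j, (x i - w i * y j) = ∏ i : Fin p, ∏ j : Fin (p + 1),
        (modeCos m (r (Fin.castAdd (p + 1) i)) - modeCos m (r (Fin.natAdd p j))) := by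
      rw [Fin.prod_univ_castSucc]
      simp only [x1, x2, w1, w2, y]
      simp
    rw [h5, h6, Fin.prod_univ_castSucc v]
    simp only [v1, v2, Finset.prod_div_distrib, Finset.prod_const_one, y]
    ring

theorem modeSum_sorted_eq_zero (hm : 0 < m) (hk : p = k + 1) (r : Fin (p + k) → ℤ)
    (hr : ∀ i, 0 < r i ∧ r i < 2 * m) (he : ∀ i, Even (r (Fin.castAdd k i))) :
    modeSum m r = 0 := by
  subst hk
  rw [modeSum_append]
  exact contractScalar_eq_zero _ _
    (fun i => contractVec (sineMode m (r (Fin.castAdd k i))) (m - 1)) _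
    (fun i => contractLeft_sineMode_of_even hm (he i))
    (fun i j => seqDual_contractVec_of_even hm (he i) (he j) (sin_pos_of_lt (hr _).1 (hr _).2).ne')

end Sorted

theorem exists_perm_sorted {p k : ℕ} (r : Fin (p + k) → ℤ)
    (hp : (Finset.univ.filter fun i => Even (r i)).card = p) :
    ∃ σ : Equiv.Perm (Fin (p + k)), (∀ i, Even (r (σ (Fin.castAdd k i)))) ∧
      ∀ j, Odd (r (σ (Fin.natAdd p j))) := by
  have hk : (Finset.univ.filter fun i => Even (r i))ᶜ.card = k := by
    rw [Finset.card_compl, hp]; simp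
  refine ⟨finSumFinEquiv.symm.trans (finSumEquivOfFinset hp hk), fun i => ?_, fun j => ?_⟩
  · have := Finset.orderEmbOfFin_mem _ hp i
    rw [Equiv.trans_apply, finSumFinEquiv_symm_apply_castAdd]
    exact (Finset.mem_filter.1 this).2
  · have := Finset.orderEmbOfFin_mem _ hk j
    rw [Finset.mem_compl, Finset.mem_filter, not_and, Int.not_even_iff_odd] at this
    rw [Equiv.trans_apply, finSumFinEquiv_symm_apply_natAdd]
    exact this (Finset.mem_univ _)

/-- A sum of determinants of modes, about half of which are even, is a product. -/
theorem exists_modeSum_eq {p k m : ℕ} (hk : k = p ∨ k = p + 1) (hm : 0 < m) :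
    ∃ K : ℝ, K ^ 2 = 1 ∧ ∀ r : Fin (p + k) → ℤ, (∀ i, 0 < r i ∧ r i < 2 * m) →
      (Finset.univ.filter fun i => Even (r i)).card = p →
      modeSum m r = K * (∏ i, modeWeight m (r i)) *
        ∏ i, ∏ j ∈ Finset.Ioi i, modePair m (r i) (r j) := by
  obtain ⟨K, hK, h⟩ := exists_modeSum_sorted_eq hk hm
  refine ⟨K, hK, fun r hr hp => ?_⟩
  obtain ⟨σ, he, ho⟩ := exists_perm_sorted r hp
  have := h (fun i => r (σ i)) (fun i => hr _) he ho
  -- Both sides are alternating in the modes, since `modePair` is antisymmetric, so sorting by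
  -- parity costs the same sign on each side.
  rw [modeSum_comp_perm, prod_modePair_comp_perm, Equiv.prod_comp σ fun i => modeWeight m (r i)]
    at this
  have hs : ((σ.sign : ℤ) : ℝ) ≠ 0 := by exact_mod_cast (σ.sign).ne_zero
  apply mul_left_cancel₀ hs
  rw [this]
  ring

theorem modeSum_eq_zero {p k m : ℕ} (hm : 0 < m) (hk : p = k + 1) (r : Fin (p + k) → ℤ)
    (hr : ∀ i, 0 < r i ∧ r i < 2 * m) (hp : (Finset.univ.filter fun i => Even (r i)).card = p) :
    modeSum m r = 0 := by
  obtain ⟨σ, he, -⟩ := exists_perm_sorted r hp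
  have := modeSum_sorted_eq_zero hm hk (fun i => r (σ i)) (fun i => hr _) he
  rw [modeSum_comp_perm] at this
  exact (mul_eq_zero.1 this).resolve_left (by exact_mod_cast (σ.sign).ne_zero)

/-! ### The determinant of the lowest modes -/

theorem prod_prod_Ioi_eq_prod_range (n : ℕ) (F : ℕ → ℕ → ℝ) :
    ∏ i : Fin n, ∏ j ∈ Finset.Ioi i, F i j =
      ∏ j ∈ Finset.range n, ∏ i ∈ Finset.range j, F i j := by
  have h : ∀ i : Fin n, ∏ j ∈ Finset.Ioi i, F i j = ∏ j : Fin n, if i < j then F i j else 1 :=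
    fun i => prod_Ioi_eq_prod_ite i fun j => F i j
  simp only [h]
  rw [Finset.prod_comm, ← Fin.prod_univ_eq_prod_range (fun j => ∏ i ∈ Finset.range j, F i j)]
  refine Finset.prod_congr rfl fun j _ => ?_
  have h2 := Fin.prod_univ_eq_prod_range (fun i => if i < (j : ℕ) then F i j else 1) n
  simp only [Fin.lt_def]
  rw [h2, ← Finset.prod_filter]
  congr 1
  ext i
  simp
  omega

-- Since sin((i+1)θ) = sin θ · U_i(cos θ) and U_i has leading coefficient 2^i, the determinant is a
-- Vandermonde determinant in cosines, each difference of which splits into two sines. The powers of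
-- 2 from the leading coefficients and from these splittings are equal, hence the exponent n(n-1).
open Polynomial in
theorem det_sineMode (n m : ℕ) (x : Fin n → ℤ) :
    (Matrix.of fun i j : Fin n => sineMode m ((i : ℤ) + 1) (x j)).det =
      2 ^ (n * (n - 1)) * (∏ i, ∏ j ∈ Finset.Ioi i,
          Real.sin ((x i - x j : ℤ) * Real.pi / (2 * m))) *
        ∏ i, ∏ j ∈ Finset.Ici i, Real.sin ((x i + x j : ℤ) * Real.pi / (2 * m)) := by
  let q : Fin n → ℝ[X] := fun i => C ((2 : ℝ) ^ (i : ℕ))⁻¹ * Chebyshev.U ℝ (i : ℤ)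
  have hU : ∀ i : ℕ, (Chebyshev.U ℝ (i : ℤ)).natDegree = i ∧
      (Chebyshev.U ℝ (i : ℤ)).leadingCoeff = 2 ^ i := fun i => by
    constructor <;> simp
  have h0 : ∀ i : ℕ, ((2 : ℝ) ^ i)⁻¹ ≠ 0 := fun i => by positivity
  have hq := Matrix.det_eval_matrixOfPolynomials_eq_det_vandermonde
    (fun j => modeCos m (x j)) q
    (fun i => by rw [natDegree_C_mul (h0 _), (hU i).1])
    (fun i => by
      rw [Monic, leadingCoeff_mul, leadingCoeff_C, (hU i).2]
      exact inv_mul_cancel₀ (by positivity))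
  rw [Matrix.det_vandermonde] at hq
  have h1 : (Matrix.of fun i j : Fin n => sineMode m ((i : ℤ) + 1) (x j)).det =
      (Matrix.of fun i j : Fin n => Real.sin (x i * Real.pi / m) *
        (Matrix.of fun i j : Fin n => (2 : ℝ) ^ (j : ℕ) * (Matrix.of fun i j : Fin n =>
          (q j).eval (modeCos m (x i))) i j) i j).det := by
    rw [← Matrix.det_transpose]
    congr 1
    ext j i
    simp only [Matrix.transpose_apply, Matrix.of_apply, q, eval_mul, eval_C]
    rw [mul_inv_cancel_left₀ (by positivity), mul_comm, modeCos, Chebyshev.U_real_cos, sineMode]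
    congr 1
    push_cast
    ring
  have hsplit : ∀ i : Fin n, ∏ j ∈ Finset.Ici i, Real.sin ((x i + x j : ℤ) * Real.pi / (2 * m)) =
      Real.sin (x i * Real.pi / m) * ∏ j ∈ Finset.Ioi i,
        Real.sin ((x i + x j : ℤ) * Real.pi / (2 * m)) := fun i => by
    rw [← Finset.Ioi_insert, Finset.prod_insert (by simp)]
    congr 2
    push_cast
    ring
  have h2 : ∏ i : Fin n, (2 : ℝ) ^ (i : ℕ) = ∏ i : Fin n, ∏ j ∈ Finset.Ioi i, 2 := by
    rw [prod_prod_Ioi_eq_prod_range n fun _ _ => 2,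
      Fin.prod_univ_eq_prod_range (fun i => (2 : ℝ) ^ i)]
    simp
  have h3 : (2 : ℝ) ^ (n * (n - 1)) = (∏ i : Fin n, (2 : ℝ) ^ (i : ℕ)) ^ 2 := by
    rw [Fin.prod_univ_eq_prod_range (fun i => (2 : ℝ) ^ i), Finset.prod_pow_eq_pow_sum,
      ← pow_mul, Finset.sum_range_id_mul_two]
  rw [h1, Matrix.det_mul_column, Matrix.det_mul_row, ← hq, h3, h2]
  simp only [hsplit, Finset.prod_mul_distrib, modeCos_sub]
  ring

theorem det_sineMode_pos {n m : ℕ} (x : Fin n → ℤ) (hx : StrictAnti x)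
    (hx' : ∀ i, 0 < x i ∧ x i < m) :
    0 < (Matrix.of fun i j : Fin n => sineMode m ((i : ℤ) + 1) (x j)).det := by
  rw [det_sineMode]
  refine mul_pos (mul_pos (by positivity) ?_) ?_
  · refine Finset.prod_pos fun i _ => Finset.prod_pos fun j hj => sin_pos_of_lt ?_ ?_
    · have := hx (Finset.mem_Ioi.1 hj); omega
    · have := (hx' i).2; have := (hx' j).1; omega
  · refine Finset.prod_pos fun i _ => Finset.prod_pos fun j hj => sin_pos_of_lt ?_ ?_
    · have := (hx' i).1; have := (hx' j).1; omega
    · have := (hx' i).2; have := (hx' j).2; omega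

/-! ### Products of sines -/

theorem prod_range_two_mul (f : ℕ → ℝ) (p : ℕ) :
    ∏ i ∈ Finset.range (2 * p), f i = ∏ l ∈ Finset.range p, (f (2 * l) * f (2 * l + 1)) := by
  induction p with
  | zero => simp
  | succ p ih => rw [Finset.prod_range_succ, ← ih, mul_add_one, Finset.prod_range_succ,
      Finset.prod_range_succ, mul_assoc]

/-- Meant for s k = sin(kπ/2m), with the left product running over `modePair` for a fixed larger
mode. The inverted factors involve only odd indices, and the squared product restores them; the odd
index 2p+1 is the only one left over. The factors 2 cancel between even and odd distances. -/
theorem prod_sq_odd_of_even (s : ℕ → ℝ) (hs : ∀ i, s (2 * i + 1) ≠ 0) (p : ℕ) :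
    (∏ i ∈ Finset.range (2 * p), if Even (2 * p - i) then 2 * (s (2 * p - i) * s (2 * p + i + 2))
        else 1 / (2 * (s (2 * p - i) * s (2 * p + i + 2)))) *
      (∏ d ∈ Finset.range (2 * p + 1), s (2 * d + 1)) ^ 2 =
    s (2 * p + 1) ^ 2 * ∏ i ∈ Finset.range (2 * p), (s (2 * p - i) * s (2 * p + i + 2)) := by
  have h1 : ∏ d ∈ Finset.range (2 * p + 1), s (2 * d + 1) = s (2 * p + 1) *
      ∏ l ∈ Finset.range p, (s (2 * p - (2 * l + 1)) * s (2 * p + (2 * l + 1) + 2)) := by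
    have r1 : ∏ l ∈ Finset.range p, s (2 * p - (2 * l + 1)) =
        ∏ l ∈ Finset.range p, s (2 * l + 1) := by
      rw [← Finset.prod_range_reflect (fun l => s (2 * l + 1))]
      refine Finset.prod_congr rfl fun l hl => ?_
      rw [Finset.mem_range] at hl
      congr 1; omega
    rw [show Finset.range (2 * p + 1) = Finset.range (p + 1 + p) by congr 1; ring,
      Finset.prod_range_add, Finset.prod_range_succ, Finset.prod_mul_distrib, r1,
      mul_comm _ (s (2 * p + 1)), mul_assoc]
    congr 2
    refine Finset.prod_congr rfl fun l _ => ?_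
    congr 1; ring
  rw [h1, prod_range_two_mul, prod_range_two_mul, mul_pow, mul_left_comm, ← Finset.prod_pow,
    ← Finset.prod_mul_distrib]
  congr 1
  refine Finset.prod_congr rfl fun l hl => ?_
  rw [Finset.mem_range] at hl
  rw [if_pos (by rw [← Nat.mul_sub]; exact even_two_mul _), if_neg (by
    rw [Nat.not_even_iff_odd]; exact ⟨p - l - 1, by omega⟩)]
  have a1 : s (2 * p - (2 * l + 1)) ≠ 0 := by
    rw [show 2 * p - (2 * l + 1) = 2 * (p - l - 1) + 1 by omega]; exact hs _
  have a2 : s (2 * p + (2 * l + 1) + 2) ≠ 0 := by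
    rw [show 2 * p + (2 * l + 1) + 2 = 2 * (p + l + 1) + 1 by omega]; exact hs _
  field_simp

/-- Now the inverted factors use up all odd indices, but they are one more than the others, so one
factor 1/2 remains to be compensated. -/
theorem prod_sq_odd_of_odd (s : ℕ → ℝ) (hs : ∀ i, s (2 * i + 1) ≠ 0) (p : ℕ) :
    2 * (∏ i ∈ Finset.range (2 * p + 1),
        if Even (2 * p + 1 - i) then 2 * (s (2 * p + 1 - i) * s (2 * p + 1 + i + 2))
        else 1 / (2 * (s (2 * p + 1 - i) * s (2 * p + 1 + i + 2)))) *
      (∏ d ∈ Finset.range (2 * p + 1 + 1), s (2 * d + 1)) ^ 2 =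
    ∏ i ∈ Finset.range (2 * p + 1), (s (2 * p + 1 - i) * s (2 * p + 1 + i + 2)) := by
  have h1 : ∏ d ∈ Finset.range (2 * p + 1 + 1), s (2 * d + 1) =
      (∏ l ∈ Finset.range p, (s (2 * p + 1 - 2 * l) * s (2 * p + 1 + 2 * l + 2))) *
        (s (2 * p + 1 - 2 * p) * s (2 * p + 1 + 2 * p + 2)) := by
    rw [← Finset.prod_range_succ
      (fun l => s (2 * p + 1 - 2 * l) * s (2 * p + 1 + 2 * l + 2)),
      show 2 * p + 1 + 1 = p + 1 + (p + 1) by ring, Finset.prod_range_add,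
      Finset.prod_mul_distrib, ← Finset.prod_range_reflect]
    congr 1
    · refine Finset.prod_congr rfl fun l hl => ?_
      rw [Finset.mem_range] at hl
      congr 1; omega
    · refine Finset.prod_congr rfl fun l hl => ?_
      congr 1; omega
  have hodd : ∀ l, l ≤ p → ¬ Even (2 * p + 1 - 2 * l) := fun l hl => by
    rw [Nat.not_even_iff_odd]; exact ⟨p - l, by omega⟩
  have a1 : ∀ l, l ≤ p → s (2 * p + 1 - 2 * l) ≠ 0 := fun l hl => by
    rw [show 2 * p + 1 - 2 * l = 2 * (p - l) + 1 by omega]; exact hs _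
  have a2 : ∀ l, s (2 * p + 1 + 2 * l + 2) ≠ 0 := fun l => by
    rw [show 2 * p + 1 + 2 * l + 2 = 2 * (p + l + 1) + 1 by omega]; exact hs _
  rw [h1, Finset.prod_range_succ, Finset.prod_range_succ, if_neg (hodd p le_rfl),
    prod_range_two_mul, prod_range_two_mul, mul_pow, ← Finset.prod_pow]
  have h2 : ∀ x ∈ Finset.range p, (s (2 * p + 1 - 2 * x) * s (2 * p + 1 + 2 * x + 2)) *
      (s (2 * p + 1 - (2 * x + 1)) * s (2 * p + 1 + (2 * x + 1) + 2)) =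
      ((if Even (2 * p + 1 - 2 * x) then 2 * (s (2 * p + 1 - 2 * x) * s (2 * p + 1 + 2 * x + 2))
        else 1 / (2 * (s (2 * p + 1 - 2 * x) * s (2 * p + 1 + 2 * x + 2)))) *
      (if Even (2 * p + 1 - (2 * x + 1)) then
        2 * (s (2 * p + 1 - (2 * x + 1)) * s (2 * p + 1 + (2 * x + 1) + 2))
        else 1 / (2 * (s (2 * p + 1 - (2 * x + 1)) * s (2 * p + 1 + (2 * x + 1) + 2))))) *
        (s (2 * p + 1 - 2 * x) * s (2 * p + 1 + 2 * x + 2)) ^ 2 := by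
    intro l hl
    rw [Finset.mem_range] at hl
    have := a1 l hl.le
    have := a2 l
    rw [if_neg (hodd l hl.le), if_pos ⟨p - l, by omega⟩]
    field_simp
  rw [Finset.prod_congr rfl h2, Finset.prod_mul_distrib]
  have := a1 p le_rfl
  have := a2 p
  field_simp
  simp only [Finset.prod_mul_distrib]
  ring

theorem prod_rect_succ (f : ℕ → ℕ → ℝ) (n : ℕ) :
    ∏ h ∈ Finset.range (n + 1 + 1), ∏ t ∈ Finset.range (n + 1), f t h =
      (∏ h ∈ Finset.range (n + 1), ∏ t ∈ Finset.range n, f t h) *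
        (∏ h ∈ Finset.range (n + 1), f n h) * ∏ t ∈ Finset.range (n + 1), f t (n + 1) := by
  rw [Finset.prod_range_succ]
  congr 1
  rw [← Finset.prod_mul_distrib]
  exact Finset.prod_congr rfl fun h _ => Finset.prod_range_succ _ _

/-- In the induction, multiplying by sin((n+1)a) completes the shifted window of sines on the right.
The new factor sin((2n+2)a) = 2 sin((n+1)a) cos((n+1)a) then supplies the new cosine. -/
theorem prod_cos_mul_prod_sin (a : ℝ) (n : ℕ) (h : ∀ k : ℕ, 1 ≤ k → k ≤ n → Real.sin (k * a) ≠ 0) :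
    2 ^ n * (∏ j ∈ Finset.range n, Real.cos ((j + 1 : ℕ) * a)) *
      ∏ d ∈ Finset.range (n + 1), Real.sin ((2 * d + 1 : ℕ) * a) =
      ∏ i ∈ Finset.range (n + 1), Real.sin ((n + 1 + i : ℕ) * a) := by
  induction n with
  | zero => simp
  | succ n ih =>
    specialize ih fun k hk hk' => h k hk (by omega)
    have hn := h (n + 1) (by omega) le_rfl
    apply mul_left_cancel₀ hn
    have h1 : Real.sin ((n + 1 : ℕ) * a) *
        ∏ i ∈ Finset.range (n + 1 + 1), Real.sin ((n + 1 + 1 + i : ℕ) * a) =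
        (∏ i ∈ Finset.range (n + 1), Real.sin ((n + 1 + i : ℕ) * a)) *
          (Real.sin ((2 * n + 2 : ℕ) * a) * Real.sin ((2 * n + 3 : ℕ) * a)) := by
      have e1 := Finset.prod_range_succ' (fun i => Real.sin ((n + 1 + i : ℕ) * a)) (n + 2)
      have e2 := Finset.prod_range_succ (fun i => Real.sin ((n + 1 + i : ℕ) * a)) (n + 2)
      have e3 := Finset.prod_range_succ (fun i => Real.sin ((n + 1 + i : ℕ) * a)) (n + 1)
      have e4 : ∏ i ∈ Finset.range (n + 1 + 1), Real.sin ((n + 1 + 1 + i : ℕ) * a) =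
          ∏ i ∈ Finset.range (n + 2), Real.sin ((n + 1 + (i + 1) : ℕ) * a) :=
        Finset.prod_congr rfl fun i _ => by congr 3; ring
      rw [add_zero] at e1
      rw [e4, mul_comm, ← e1, e2, e3, mul_assoc,
        show n + 1 + (n + 1) = 2 * n + 2 by ring, show n + 1 + (n + 2) = 2 * n + 3 by ring]
    rw [h1, ← ih, Finset.prod_range_succ, Finset.prod_range_succ _ (n + 1),
      show ((2 * n + 2 : ℕ) : ℝ) * a = 2 * ((n + 1 : ℕ) * a) by push_cast; ring, Real.sin_two_mul,
      show 2 * (n + 1) + 1 = 2 * n + 3 by ring]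
    ring

/-- Enlarging n adds one row and one column to the rectangle, and `prod_cos_mul_prod_sin` evaluates
both. This is the identity behind Q = 1/(2^(n²) P). -/
theorem prod_cos_rect (a : ℝ) (n : ℕ) (h : ∀ k : ℕ, 1 ≤ k → k ≤ n → Real.sin (k * a) ≠ 0) :
    2 ^ (n ^ 2) * (∏ h ∈ Finset.range (n + 1), ∏ t ∈ Finset.range n,
        Real.cos (((t : ℝ) - h) * a)) *
      (∏ j ∈ Finset.range n, (∏ d ∈ Finset.range (j + 1), Real.sin ((2 * d + 1 : ℕ) * a)) ^ 2) =
      ∏ h ∈ Finset.range (n + 1), ∏ t ∈ Finset.range n, Real.sin ((t + h + 1 : ℕ) * a) := by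
  induction n with
  | zero => simp
  | succ n ih =>
    specialize ih fun k hk hk' => h k hk (by omega)
    have key := prod_cos_mul_prod_sin a n fun k hk hk' => h k hk (by omega)
    rw [prod_rect_succ fun t h => Real.cos (((t : ℝ) - h) * a),
      prod_rect_succ fun t h => Real.sin ((t + h + 1 : ℕ) * a), ← ih,
      Finset.prod_range_succ fun j => (∏ d ∈ Finset.range (j + 1), Real.sin ((2 * d + 1 : ℕ) * a)) ^ 2]
    set C := ∏ j ∈ Finset.range n, Real.cos ((j + 1 : ℕ) * a)
    set R := ∏ d ∈ Finset.range (n + 1), Real.sin ((2 * d + 1 : ℕ) * a)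
    have c1 : ∏ h ∈ Finset.range (n + 1), Real.cos (((n : ℝ) - h) * a) = C := by
      rw [← Finset.prod_range_reflect, Finset.prod_range_succ']
      simp only [add_tsub_cancel_right, tsub_zero, sub_self, zero_mul, Real.cos_zero, mul_one]
      refine Finset.prod_congr rfl fun i hi => ?_
      rw [Finset.mem_range] at hi
      rw [Nat.cast_sub (by omega)]
      congr 1; ring
    have c2 : ∏ t ∈ Finset.range (n + 1), Real.cos (((t : ℝ) - (n + 1 : ℕ)) * a) =
        C * Real.cos ((n + 1 : ℕ) * a) := by
      rw [← Finset.prod_range_succ (fun j : ℕ => Real.cos ((j + 1 : ℕ) * a)),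
        ← Finset.prod_range_reflect]
      refine Finset.prod_congr rfl fun i hi => ?_
      rw [Finset.mem_range] at hi
      rw [← Real.cos_neg, add_tsub_cancel_right, Nat.cast_sub (by omega)]
      push_cast
      congr 1; ring
    have d1 : ∏ h ∈ Finset.range (n + 1), Real.sin ((n + h + 1 : ℕ) * a) = 2 ^ n * C * R := by
      rw [key]
      exact Finset.prod_congr rfl fun i _ => by rw [add_right_comm]
    have hn := h (n + 1) (by omega) le_rfl
    have d2 : ∏ t ∈ Finset.range (n + 1), Real.sin ((t + (n + 1) + 1 : ℕ) * a) =
        2 ^ n * C * R * (2 * Real.cos ((n + 1 : ℕ) * a)) := by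
      apply mul_left_cancel₀ hn
      have e1 := Finset.prod_range_succ' (fun i => Real.sin ((n + i + 1 : ℕ) * a)) (n + 1)
      have e2 := Finset.prod_range_succ (fun i => Real.sin ((n + i + 1 : ℕ) * a)) (n + 1)
      have e4 : ∏ i ∈ Finset.range (n + 1), Real.sin ((i + (n + 1) + 1 : ℕ) * a) =
          ∏ i ∈ Finset.range (n + 1), Real.sin ((n + (i + 1) + 1 : ℕ) * a) :=
        Finset.prod_congr rfl fun i _ => by congr 3; ring
      rw [e4, mul_comm, ← d1, show n + 1 = n + 0 + 1 from rfl, ← e1, e2,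
        show ((n + (n + 1) + 1 : ℕ) : ℝ) * a = 2 * ((n + 0 + 1 : ℕ) * a) by push_cast; ring,
        Real.sin_two_mul]
      ring
    rw [c1, c2, d1, d2]
    ring

theorem prod_Icc_one_eq_prod_range (f : ℕ → ℝ) (n : ℕ) :
    ∏ h ∈ Finset.Icc 1 n, f h = ∏ h ∈ Finset.range n, f (h + 1) := by
  induction n with
  | zero => simp
  | succ n ih => rw [Finset.prod_Icc_succ_top (by omega), ih, Finset.prod_range_succ]

theorem sin_nat_mul_pos {k m : ℕ} (h0 : 0 < k) (h1 : k < 2 * m) :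
    0 < Real.sin (k * (Real.pi / (2 * m))) := by
  have := sin_pos_of_lt (m := m) (r := k) (by exact_mod_cast h0) (by exact_mod_cast h1)
  rwa [mul_div_assoc, Int.cast_natCast] at this

theorem prod_sin_odd_pos {n m : ℕ} (h : n < m) :
    0 < ∏ d ∈ Finset.range (n + 1), Real.sin ((2 * d + 1 : ℕ) * (Real.pi / (2 * m))) :=
  Finset.prod_pos fun d hd => sin_nat_mul_pos (by omega) (by rw [Finset.mem_range] at hd; omega)

/-- Enlarging n adds a row and a column to the rectangle, each of which runs over the sines of the
first n+1 odd multiples of π/2m up to sign. -/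
theorem absSineProductC_eq {n m : ℕ} (h : n < m) : absSineProductC n m =
    ∏ j ∈ Finset.range n, (∏ d ∈ Finset.range (j + 1),
      Real.sin ((2 * d + 1 : ℕ) * (Real.pi / (2 * m)))) ^ 2 := by
  rw [absSineProductC]
  simp only [prod_Icc_one_eq_prod_range]
  induction n with
  | zero => simp
  | succ n ih =>
    rw [prod_rect_succ fun t h => |Real.sin ((2 * ((t + 1 : ℕ) : ℝ) - 2 * ((h + 1 : ℕ) : ℝ) + 1) *
      Real.pi / (2 * m))|, ih (by omega), Finset.prod_range_succ
      (fun j => (∏ d ∈ Finset.range (j + 1), Real.sin ((2 * d + 1 : ℕ) * (Real.pi / (2 * m)))) ^ 2),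
      mul_assoc]
    congr 1
    have hpos : ∀ d ∈ Finset.range (n + 1),
        |Real.sin ((2 * d + 1 : ℕ) * (Real.pi / (2 * m)))| =
        Real.sin ((2 * d + 1 : ℕ) * (Real.pi / (2 * m))) := fun d hd =>
      abs_of_pos (sin_nat_mul_pos (by omega) (by rw [Finset.mem_range] at hd; omega))
    rw [sq, ← Finset.prod_congr rfl hpos, ← Finset.prod_range_reflect
      (fun d => |Real.sin ((2 * d + 1 : ℕ) * (Real.pi / (2 * m)))|)]
    congr 1
    · refine Finset.prod_congr rfl fun d hd => ?_
      rw [Finset.mem_range] at hd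
      rw [add_tsub_cancel_right]
      push_cast [Nat.cast_sub (show d ≤ n by omega)]
      congr 2
      ring
    · refine Finset.prod_congr rfl fun d hd => ?_
      rw [Finset.mem_range] at hd
      rw [add_tsub_cancel_right, ← abs_neg, ← Real.sin_neg]
      push_cast [Nat.cast_sub (show d ≤ n by omega)]
      congr 2
      ring

theorem absSineProductC_pos {n m : ℕ} (h : n < m) : 0 < absSineProductC n m := by
  rw [absSineProductC_eq h]
  exact Finset.prod_pos fun j hj => pow_pos (prod_sin_odd_pos (by
    rw [Finset.mem_range] at hj; omega)) 2

/-- The summand m in the numerators is a shift by π/2, which turns them into cosines of (t-h)π/2m;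
reversing `h` brings the denominators to the form in `prod_cos_rect`. -/
theorem sineQuotientC_eq {n m : ℕ} (h : n < m) :
    sineQuotientC n m = 1 / (2 ^ n ^ 2 * absSineProductC n m) := by
  have hm : (m : ℝ) ≠ 0 := by
    have : 0 < m := by omega
    positivity
  have key := prod_cos_rect (Real.pi / (2 * m)) n fun k hk hk' =>
    (sin_nat_mul_pos (by omega) (by omega)).ne'
  rw [← absSineProductC_eq h] at key
  have hP := absSineProductC_pos h
  have hden : 0 < ∏ h ∈ Finset.range (n + 1), ∏ t ∈ Finset.range n,
      Real.sin ((t + h + 1 : ℕ) * (Real.pi / (2 * m))) := by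
    refine Finset.prod_pos fun i hi => Finset.prod_pos fun t ht => sin_nat_mul_pos (by omega) ?_
    rw [Finset.mem_range] at hi ht
    omega
  rw [sineQuotientC, ← Nat.range_succ_eq_Icc_zero]
  simp only [prod_Icc_one_eq_prod_range, Finset.prod_div_distrib]
  have h1 : ∏ i ∈ Finset.range (n + 1), ∏ t ∈ Finset.range n,
      Real.sin (Real.pi * (((t + 1 : ℕ) : ℝ) - i + (m - 1)) / (2 * m)) =
      ∏ h ∈ Finset.range (n + 1), ∏ t ∈ Finset.range n,
        Real.cos (((t : ℝ) - h) * (Real.pi / (2 * m))) := by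
    refine Finset.prod_congr rfl fun i _ => Finset.prod_congr rfl fun t _ => ?_
    rw [← Real.sin_add_pi_div_two]
    congr 1
    push_cast
    field_simp
    ring
  have h2 : ∏ i ∈ Finset.range (n + 1), ∏ t ∈ Finset.range n,
      Real.sin (Real.pi * (((t + 1 : ℕ) : ℝ) - i + n) / (2 * m)) =
      ∏ h ∈ Finset.range (n + 1), ∏ t ∈ Finset.range n,
        Real.sin ((t + h + 1 : ℕ) * (Real.pi / (2 * m))) := by
    rw [← Finset.prod_range_reflect]
    refine Finset.prod_congr rfl fun i hi => Finset.prod_congr rfl fun t _ => ?_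
    rw [Finset.mem_range] at hi
    push_cast [Nat.cast_sub (show i ≤ n by omega), add_tsub_cancel_right]
    congr 1
    ring
  rw [h1, h2, div_eq_div_iff hden.ne' (by positivity), ← key]
  ring

theorem modePair_succ_succ {m : ℕ} {i j : ℕ} (h : i < j) :
    modePair m (i + 1) (j + 1) = if Even (j - i) then
      2 * (Real.sin ((j - i : ℕ) * (Real.pi / (2 * m))) *
        Real.sin ((j + i + 2 : ℕ) * (Real.pi / (2 * m))))
      else 1 / (2 * (Real.sin ((j - i : ℕ) * (Real.pi / (2 * m))) *
        Real.sin ((j + i + 2 : ℕ) * (Real.pi / (2 * m))))) := by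
  have h1 : modeCos m (i + 1) - modeCos m (j + 1) =
      2 * (Real.sin ((j - i : ℕ) * (Real.pi / (2 * m))) *
        Real.sin ((j + i + 2 : ℕ) * (Real.pi / (2 * m)))) := by
    rw [modeCos_sub]
    push_cast [Nat.cast_sub h.le]
    ring_nf
  have h2 : Even (((i : ℤ) + 1) - (j + 1)) ↔ Even (j - i) := by
    rw [← even_neg, ← Int.even_coe_nat, Nat.cast_sub h.le]
    ring_nf
  rw [modePair, h1]
  simp only [h2]

theorem modePair_succ_succ_pos {m i j : ℕ} (h : i < j) (hj : j + 1 < m) :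
    0 < modePair m (i + 1) (j + 1) := by
  rw [modePair_succ_succ h]
  have h1 : 0 < Real.sin ((j - i : ℕ) * (Real.pi / (2 * m))) := sin_nat_mul_pos (by omega) (by omega)
  have h2 : 0 < Real.sin ((j + i + 2 : ℕ) * (Real.pi / (2 * m))) :=
    sin_nat_mul_pos (by omega) (by omega)
  split_ifs <;> positivity

theorem cos_nat_mul_pos {k m : ℕ} (h1 : k < m) :
    0 < Real.cos (k * (Real.pi / (2 * m))) := by
  apply Real.cos_pos_of_mem_Ioo
  have hpi := Real.pi_pos
  have hm : (0 : ℝ) < m := by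
    have : 0 < m := by omega
    positivity
  constructor
  · have : 0 ≤ k * (Real.pi / (2 * m)) := by positivity
    linarith
  · rw [← mul_div_assoc, div_lt_div_iff₀ (by positivity) two_pos]
    have : (k : ℝ) < m := by exact_mod_cast h1
    nlinarith

theorem modeWeight_succ_pos {m i : ℕ} (hi : i + 1 < m) : 0 < modeWeight m (i + 1) := by
  rw [modeWeight]
  have e : (((i : ℤ) + 1 : ℤ) : ℝ) = ((i + 1 : ℕ) : ℝ) := by push_cast; rfl
  split_ifs
  · rw [e, show ((i + 1 : ℕ) : ℝ) * Real.pi / m = ((2 * (i + 1) : ℕ) : ℝ) * (Real.pi / (2 * m)) by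
      push_cast; field_simp]
    exact sin_nat_mul_pos (by omega) (by omega)
  · rw [e, mul_div_assoc]
    exact div_pos (cos_nat_mul_pos hi) (sin_nat_mul_pos (by omega) (by omega))

/-- The product formula for the lowest modes. -/
theorem two_mul_modeWeight_mul_prod (m j : ℕ) (hj : j + 1 < m) :
    2 * (modeWeight m (j + 1) * ∏ i ∈ Finset.range j, modePair m (i + 1) (j + 1)) *
      (∏ d ∈ Finset.range (j + 1), Real.sin ((2 * d + 1 : ℕ) * (Real.pi / (2 * m)))) ^ 2 =
      Real.sin ((2 * (j + 1) : ℕ) * (Real.pi / (2 * m))) *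
        ∏ i ∈ Finset.range j, (Real.sin ((j - i : ℕ) * (Real.pi / (2 * m))) *
          Real.sin ((j + i + 2 : ℕ) * (Real.pi / (2 * m)))) := by
  have hs : ∀ i : ℕ, Real.sin ((2 * i + 1 : ℕ) * (Real.pi / (2 * m))) ≠ 0 := fun i => by
    have := sin_ne_zero_of_odd (m := m) (by omega) (r := 2 * i + 1) ⟨i, rfl⟩
    push_cast at this ⊢
    rwa [mul_div_assoc] at this
  have e : (((j : ℤ) + 1 : ℤ) : ℝ) * Real.pi / (2 * m) = ((j + 1 : ℕ) : ℝ) * (Real.pi / (2 * m)) := by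
    push_cast; ring
  have e2 : (((j : ℤ) + 1 : ℤ) : ℝ) * Real.pi / m = ((2 * (j + 1) : ℕ) : ℝ) * (Real.pi / (2 * m)) := by
    push_cast; field_simp
  have e3 : Real.sin ((2 * (j + 1) : ℕ) * (Real.pi / (2 * m))) =
      2 * Real.sin ((j + 1 : ℕ) * (Real.pi / (2 * m))) *
        Real.cos ((j + 1 : ℕ) * (Real.pi / (2 * m))) := by
    rw [← Real.sin_two_mul]; push_cast; ring_nf
  have hpair : ∏ i ∈ Finset.range j, modePair m (i + 1) (j + 1) =
      ∏ i ∈ Finset.range j, _ := Finset.prod_congr rfl fun i hi =>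
    modePair_succ_succ (Finset.mem_range.1 hi)
  rw [hpair, modeWeight, e, e2]
  rcases Nat.even_or_odd' j with ⟨p, rfl | rfl⟩
  · have := prod_sq_odd_of_even (fun k => Real.sin (k * (Real.pi / (2 * m)))) hs p
    rw [if_neg (by rw [Int.not_even_iff_odd]; exact ⟨p, by push_cast; ring⟩)]
    have hs' := hs p
    rw [mul_assoc, mul_assoc, this, e3]
    field_simp
  · have := prod_sq_odd_of_odd (fun k => Real.sin (k * (Real.pi / (2 * m)))) hs p
    rw [if_pos ⟨p + 1, by push_cast; ring⟩, ← this]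
    ring

theorem prod_lowest_modes (m n : ℕ) (h : n < m) :
    2 ^ n * ((∏ i : Fin n, modeWeight m ((i : ℤ) + 1)) *
      ∏ i : Fin n, ∏ j ∈ Finset.Ioi i, modePair m ((i : ℤ) + 1) ((j : ℤ) + 1)) *
        absSineProductC n m =
      ∏ j ∈ Finset.range n, (Real.sin ((2 * (j + 1) : ℕ) * (Real.pi / (2 * m))) *
        ∏ i ∈ Finset.range j, (Real.sin ((j - i : ℕ) * (Real.pi / (2 * m))) *
          Real.sin ((j + i + 2 : ℕ) * (Real.pi / (2 * m))))) := by
  rw [prod_prod_Ioi_eq_prod_range n fun i j => modePair m ((i : ℤ) + 1) ((j : ℤ) + 1),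
    Fin.prod_univ_eq_prod_range fun i => modeWeight m ((i : ℤ) + 1), absSineProductC_eq h,
    ← Finset.prod_mul_distrib, ← Finset.prod_congr rfl fun j hj => two_mul_modeWeight_mul_prod m j
      (by rw [Finset.mem_range] at hj; omega)]
  simp [Finset.prod_mul_distrib]

/-! ### Parity counts and the sign of the product formula -/

theorem exists_modeSum_eq_of_card {n m : ℕ} (hm : 0 < m) :
    ∃ K : ℝ, K ^ 2 = 1 ∧ ∀ r : Fin n → ℤ, (∀ i, 0 < r i ∧ r i < 2 * m) →
      (Finset.univ.filter fun i => Even (r i)).card = n / 2 →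
      modeSum m r = K * (∏ i, modeWeight m (r i)) *
        ∏ i, ∏ j ∈ Finset.Ioi i, modePair m (r i) (r j) := by
  obtain ⟨p, k, hn, hp, hk⟩ : ∃ p k, n = p + k ∧ n / 2 = p ∧ (k = p ∨ k = p + 1) :=
    ⟨n / 2, n - n / 2, by omega, rfl, by omega⟩
  rw [hp]
  subst hn
  exact exists_modeSum_eq hk hm

theorem modeSum_eq_zero_of_card {n m : ℕ} (hm : 0 < m) (hn : Odd n) (r : Fin n → ℤ)
    (hr : ∀ i, 0 < r i ∧ r i < 2 * m)
    (hc : (Finset.univ.filter fun i => Even (r i)).card = n - n / 2) : modeSum m r = 0 := by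
  obtain ⟨p, k, hn, hp, hk⟩ : ∃ p k, n = p + k ∧ n - n / 2 = p ∧ p = k + 1 :=
    ⟨n - n / 2, n / 2, by omega, rfl, by obtain ⟨l, rfl⟩ := hn; omega⟩
  rw [hp] at hc
  subst hn
  exact modeSum_eq_zero hm hk r hr hc

theorem card_filter_even_succ (n : ℕ) :
    (Finset.univ.filter fun i : Fin n => Even ((i : ℤ) + 1)).card = n / 2 := by
  rw [Finset.card_filter, Fin.sum_univ_eq_sum_range (fun i => if Even ((i : ℤ) + 1) then 1 else 0)]
  induction n with
  | zero => rfl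
  | succ n ih =>
    rw [Finset.sum_range_succ, ih]
    split_ifs with h
    · obtain ⟨l, hl⟩ := h; omega
    · rw [Int.not_even_iff_odd] at h; obtain ⟨l, hl⟩ := h; omega

theorem card_filter_even_sub_of_even {m : ℕ} (n : ℕ) (hm : Even m) :
    (Finset.univ.filter fun i : Fin n => Even ((m : ℤ) - ((i : ℤ) + 1))).card = n / 2 := by
  rw [← card_filter_even_succ]
  congr 1
  ext i
  simp [Int.even_sub, hm]

theorem card_filter_even_sub_of_odd {m : ℕ} (n : ℕ) (hm : Odd m) :
    (Finset.univ.filter fun i : Fin n => Even ((m : ℤ) - ((i : ℤ) + 1))).card = n - n / 2 := by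
  have h := Finset.card_filter_add_card_filter_not (s := (Finset.univ : Finset (Fin n)))
    fun i => Even ((i : ℤ) + 1)
  rw [card_filter_even_succ, Finset.card_univ, Fintype.card_fin] at h
  have : (Finset.univ.filter fun i : Fin n => Even ((m : ℤ) - ((i : ℤ) + 1))) =
      Finset.univ.filter fun i : Fin n => ¬ Even ((i : ℤ) + 1) := by
    ext i
    have hm' : ¬ Even (m : ℤ) := by rw [Int.not_even_iff_odd]; exact_mod_cast hm
    simp only [Finset.mem_filter, Finset.mem_univ, true_and, Int.even_sub, hm', false_iff]
  rw [this]
  omega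

theorem strictAntiSeqs_nonempty {n m : ℕ} (h : n < m) : (strictAntiSeqs n (m - 1)).Nonempty := by
  refine ⟨fun i => (n : ℤ) - i, mem_strictAntiSeqs.2 ⟨fun i => ?_, fun i j hij => ?_⟩⟩
  · have := i.2; omega
  · have : (i : ℕ) < j := hij
    simp only
    omega

theorem mem_strictAntiSeqs_sub_one {n m : ℕ} {x : Fin n → ℤ} :
    x ∈ strictAntiSeqs n (m - 1) ↔ (∀ i, 0 < x i ∧ x i < m) ∧ StrictAnti x := by
  rw [mem_strictAntiSeqs]
  refine and_congr_left fun _ => forall_congr' fun i => ?_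
  omega

theorem modeSum_low_pos {n m : ℕ} (h : n < m) : 0 < modeSum m fun i : Fin n => (i : ℤ) + 1 :=
  Finset.sum_pos (fun x hx => det_sineMode_pos x (mem_strictAntiSeqs_sub_one.1 hx).2
    (mem_strictAntiSeqs_sub_one.1 hx).1) (strictAntiSeqs_nonempty h)

theorem low_mem {n m : ℕ} (h : n < m) (i : Fin n) : 0 < (i : ℤ) + 1 ∧ (i : ℤ) + 1 < 2 * m := by
  have := i.2; omega

theorem high_mem {n m : ℕ} (h : n < m) (i : Fin n) :
    0 < (m : ℤ) - ((i : ℤ) + 1) ∧ (m : ℤ) - ((i : ℤ) + 1) < 2 * m := by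
  have := i.2; omega

theorem prod_low_pos {n m : ℕ} (h : n < m) : 0 < (∏ i : Fin n, modeWeight m ((i : ℤ) + 1)) *
      ∏ i : Fin n, ∏ j ∈ Finset.Ioi i, modePair m ((i : ℤ) + 1) ((j : ℤ) + 1) := by
  refine mul_pos (Finset.prod_pos fun i _ => modeWeight_succ_pos (by have := i.2; omega)) ?_
  refine Finset.prod_pos fun i _ => Finset.prod_pos fun j hj => modePair_succ_succ_pos
    (Fin.lt_def.1 (Finset.mem_Ioi.1 hj)) (by have := j.2; omega)

/-- The sign `K` is the same for all families, and for the modes 1, …, n both the sum and the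
product are positive. Hence K = 1. -/
theorem modeSum_eq_of_card {n m : ℕ} (h : n < m) (r : Fin n → ℤ)
    (hr : ∀ i, 0 < r i ∧ r i < 2 * m)
    (hc : (Finset.univ.filter fun i => Even (r i)).card = n / 2) :
    modeSum m r = (∏ i, modeWeight m (r i)) *
        ∏ i, ∏ j ∈ Finset.Ioi i, modePair m (r i) (r j) := by
  obtain ⟨K, hK, H⟩ := exists_modeSum_eq_of_card (n := n) (m := m) (by omega)
  have h1 := H (fun i => (i : ℤ) + 1) (low_mem h) (card_filter_even_succ n)
  have h2 := modeSum_low_pos h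
  have h3 := prod_low_pos h
  rw [h1, mul_assoc] at h2
  have hK1 : K = 1 := by
    rcases mul_self_eq_one_iff.1 ((sq K).symm.trans hK) with rfl | rfl
    · rfl
    · linarith
  rw [H r hr hc, hK1, one_mul]

/-! ### The highest modes compared with the lowest -/

theorem modeCos_sub_left {m : ℕ} (hm : 0 < m) (a : ℤ) : modeCos m (m - a) = -modeCos m a := by
  rw [modeCos, modeCos, ← Real.cos_pi_sub]
  have : (m : ℝ) ≠ 0 := by positivity
  congr 1
  push_cast
  field_simp

theorem modePair_sub_left {m : ℕ} (hm : 0 < m) (a b : ℤ) :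
    modePair m (m - a) (m - b) = -modePair m a b := by
  have h : Even ((m : ℤ) - a - (m - b)) ↔ Even (a - b) := by
    rw [← even_neg]; ring_nf
  rw [modePair, modePair, modeCos_sub_left hm, modeCos_sub_left hm]
  simp only [h]
  split_ifs
  · ring
  · rw [show -modeCos m a - -modeCos m b = -(modeCos m a - modeCos m b) by ring, one_div, one_div,
      inv_neg]

theorem prod_modePair_sub_left {m : ℕ} (hm : 0 < m) (n : ℕ) :
    ∏ i : Fin n, ∏ j ∈ Finset.Ioi i,
      modePair m ((m : ℤ) - ((i : ℤ) + 1)) ((m : ℤ) - ((j : ℤ) + 1)) =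
    (-1) ^ (∑ i ∈ Finset.range n, i) *
      ∏ i : Fin n, ∏ j ∈ Finset.Ioi i, modePair m ((i : ℤ) + 1) ((j : ℤ) + 1) := by
  have : ∏ i : Fin n, ∏ j ∈ Finset.Ioi i, (-1 : ℝ) = (-1) ^ (∑ i ∈ Finset.range n, i) := by
    rw [prod_prod_Ioi_eq_prod_range n fun _ _ => (-1 : ℝ), ← Finset.prod_pow_eq_pow_sum]
    simp
  simp only [modePair_sub_left hm, ← this, ← Finset.prod_mul_distrib, neg_one_mul]

theorem sin_sub_half {m : ℕ} (hm : 0 < m) (a : ℤ) :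
    Real.sin ((m - a : ℤ) * Real.pi / (2 * m)) = Real.cos (a * Real.pi / (2 * m)) ∧
    Real.cos ((m - a : ℤ) * Real.pi / (2 * m)) = Real.sin (a * Real.pi / (2 * m)) := by
  have : (m : ℝ) ≠ 0 := by positivity
  have h : ((m - a : ℤ) : ℝ) * Real.pi / (2 * m) = Real.pi / 2 - a * Real.pi / (2 * m) := by
    push_cast
    field_simp
  rw [h, Real.sin_pi_div_two_sub, Real.cos_pi_div_two_sub]
  exact ⟨rfl, rfl⟩

theorem sin_sub_full {m : ℕ} (hm : 0 < m) (a : ℤ) :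
    Real.sin ((m - a : ℤ) * Real.pi / m) = Real.sin (a * Real.pi / m) := by
  have : (m : ℝ) ≠ 0 := by positivity
  rw [← Real.sin_pi_sub]
  congr 1
  push_cast
  field_simp
  ring

theorem sin_full_eq (m : ℕ) (a : ℤ) : Real.sin (a * Real.pi / m) =
    2 * Real.sin (a * Real.pi / (2 * m)) * Real.cos (a * Real.pi / (2 * m)) := by
  rw [← Real.sin_two_mul]
  ring_nf

theorem modeWeight_sub_left_of_even {m : ℕ} (hm : 0 < m) (hme : Even m) {a : ℤ} (ha : 0 < a)
    (ha' : a < m) : modeWeight m (m - a) = modeWeight m a *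
      if Even a then 1 else Real.tan (a * Real.pi / (2 * m)) ^ 2 := by
  have h : Even ((m : ℤ) - a) ↔ Even a := by simp [Int.even_sub, hme]
  have hs := (sin_pos_of_lt (m := m) ha (by omega)).ne'
  rw [modeWeight, modeWeight, sin_sub_full hm, (sin_sub_half hm a).1, (sin_sub_half hm a).2]
  simp only [h]
  split_ifs
  · rw [mul_one]
  · have hc : Real.cos (a * Real.pi / (2 * m)) ≠ 0 := by
      rw [← (sin_sub_half hm a).1]
      exact (sin_pos_of_lt (by omega) (by omega)).ne'
    rw [Real.tan_eq_sin_div_cos]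
    field_simp

theorem modeWeight_sub_left_of_odd {m : ℕ} (hm : 0 < m) (hmo : Odd m) {a : ℤ} (ha : 0 < a)
    (ha' : a < m) : modeWeight m (m - a) = modeWeight m a *
      if Even a then 1 / (2 * Real.cos (a * Real.pi / (2 * m)) ^ 2)
      else 2 * Real.sin (a * Real.pi / (2 * m)) ^ 2 := by
  have hm' : ¬ Even (m : ℤ) := by rw [Int.not_even_iff_odd]; exact_mod_cast hmo
  have h : Even ((m : ℤ) - a) ↔ ¬ Even a := by simp only [Int.even_sub, hm', false_iff]
  have hs := (sin_pos_of_lt (m := m) ha (by omega)).ne'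
  have hc : Real.cos (a * Real.pi / (2 * m)) ≠ 0 := by
    rw [← (sin_sub_half hm a).1]
    exact (sin_pos_of_lt (by omega) (by omega)).ne'
  rw [modeWeight, modeWeight, sin_sub_full hm, (sin_sub_half hm a).1, (sin_sub_half hm a).2,
    sin_full_eq]
  simp only [h]
  split_ifs
  · field_simp
  · field_simp

theorem prod_range_ite_even_succ (n : ℕ) (f g : ℕ → ℝ) :
    (∏ i ∈ Finset.range n, if Even ((i : ℤ) + 1) then f (i + 1) else g (i + 1)) =
      (∏ h ∈ Finset.Icc 1 (n / 2), f (2 * h)) * ∏ h ∈ Finset.Icc 1 ((n + 1) / 2), g (2 * h - 1) := by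
  induction n with
  | zero => simp
  | succ n ih =>
    rw [Finset.prod_range_succ, ih]
    rcases Nat.even_or_odd' n with ⟨p, rfl | rfl⟩
    · rw [if_neg (by rw [Int.not_even_iff_odd]; exact ⟨p, by push_cast; ring⟩),
        show (2 * p + 1) / 2 = 2 * p / 2 by omega, show (2 * p + 1 + 1) / 2 = 2 * p / 2 + 1 by omega,
        Finset.prod_Icc_succ_top (by omega), show 2 * (2 * p / 2 + 1) - 1 = 2 * p + 1 by omega]
      ring
    · rw [if_pos ⟨p + 1, by push_cast; ring⟩,
        show (2 * p + 1 + 1 + 1) / 2 = p + 1 by omega, show (2 * p + 1 + 1) / 2 = p + 1 by omega,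
        show (2 * p + 1) / 2 = p by omega,
        Finset.prod_Icc_succ_top (by omega) (fun h => f (2 * h)),
        show 2 * (p + 1) = 2 * p + 1 + 1 by omega]
      ring

/-- The reflection r ↦ m - r negates all cosines, hence every `modePair`, which accounts for the
sign. For even m it preserves parity: weights of even modes are unchanged, while the cotangent of an
odd mode becomes a tangent. -/
theorem modeSum_high_of_even {n m : ℕ} (h : n < m) (hm : Even m) :
    modeSum m (fun i : Fin n => (m : ℤ) - ((i : ℤ) + 1)) =
      (-1) ^ (∑ i ∈ Finset.range n, i) * (∏ h ∈ Finset.Icc 1 ((n + 1) / 2),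
        Real.tan ((2 * (h : ℝ) - 1) * Real.pi / (2 * m)) ^ 2) *
        modeSum m fun i : Fin n => (i : ℤ) + 1 := by
  have hm0 : 0 < m := by omega
  rw [modeSum_eq_of_card h _ (high_mem h) (card_filter_even_sub_of_even n hm),
    modeSum_eq_of_card h _ (low_mem h) (card_filter_even_succ n), prod_modePair_sub_left hm0,
    Finset.prod_congr rfl fun (i : Fin n) _ => modeWeight_sub_left_of_even hm0 hm
      (a := (i : ℤ) + 1) (by omega) (by have := i.2; omega), Finset.prod_mul_distrib]
  have h2 := Fin.prod_univ_eq_prod_range (fun i => if Even ((i : ℤ) + 1) then (1 : ℝ) else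
    Real.tan (((i : ℤ) + 1 : ℤ) * Real.pi / (2 * m)) ^ 2) n
  have h3 := prod_range_ite_even_succ n (fun _ => 1)
    fun i => Real.tan (i * Real.pi / (2 * m)) ^ 2
  have h4 : ∀ h ∈ Finset.Icc 1 ((n + 1) / 2),
      Real.tan ((2 * h - 1 : ℕ) * Real.pi / (2 * m)) ^ 2 =
        Real.tan ((2 * (h : ℝ) - 1) * Real.pi / (2 * m)) ^ 2 := fun h hh => by
    rw [Finset.mem_Icc] at hh
    push_cast [Nat.cast_sub (show 1 ≤ 2 * h by omega)]
    rfl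
  rw [Finset.prod_const_one, one_mul, Finset.prod_congr rfl h4] at h3
  push_cast at h2 h3 ⊢
  rw [h2, h3]
  ring

/-- For odd m the reflection exchanges the parities, and so the two kinds of weights. As n is even,
half of the reflected modes are still even, so the product formula applies and the factors 2 cancel
in pairs. -/
theorem modeSum_high_of_odd {n m : ℕ} (h : n < m) (hm : Odd m) (hn : Even n) :
    modeSum m (fun i : Fin n => (m : ℤ) - ((i : ℤ) + 1)) =
      (-1) ^ (∑ i ∈ Finset.range n, i) * (∏ h ∈ Finset.Icc 1 (n / 2),
        Real.sin ((2 * (h : ℝ) - 1) * Real.pi / (2 * m)) ^ 2 /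
          Real.cos ((h : ℝ) * Real.pi / m) ^ 2) *
        modeSum m fun i : Fin n => (i : ℤ) + 1 := by
  have hm0 : 0 < m := by omega
  rw [modeSum_eq_of_card h _ (high_mem h) (by
      rw [card_filter_even_sub_of_odd n hm]; obtain ⟨p, rfl⟩ := hn; omega),
    modeSum_eq_of_card h _ (low_mem h) (card_filter_even_succ n), prod_modePair_sub_left hm0,
    Finset.prod_congr rfl fun (i : Fin n) _ => modeWeight_sub_left_of_odd hm0 hm
      (a := (i : ℤ) + 1) (by omega) (by have := i.2; omega), Finset.prod_mul_distrib]
  have h2 := Fin.prod_univ_eq_prod_range (fun i => if Even ((i : ℤ) + 1) then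
    1 / (2 * Real.cos (((i : ℤ) + 1 : ℤ) * Real.pi / (2 * m)) ^ 2) else
    2 * Real.sin (((i : ℤ) + 1 : ℤ) * Real.pi / (2 * m)) ^ 2) n
  have h3 := prod_range_ite_even_succ n (fun i => 1 / (2 * Real.cos (i * Real.pi / (2 * m)) ^ 2))
    fun i => 2 * Real.sin (i * Real.pi / (2 * m)) ^ 2
  rw [show (n + 1) / 2 = n / 2 by obtain ⟨p, rfl⟩ := hn; omega, ← Finset.prod_mul_distrib] at h3
  have h4 : ∀ h ∈ Finset.Icc 1 (n / 2),
      1 / (2 * Real.cos ((2 * h : ℕ) * Real.pi / (2 * m)) ^ 2) *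
        (2 * Real.sin ((2 * h - 1 : ℕ) * Real.pi / (2 * m)) ^ 2) =
        Real.sin ((2 * (h : ℝ) - 1) * Real.pi / (2 * m)) ^ 2 /
          Real.cos ((h : ℝ) * Real.pi / m) ^ 2 := fun h hh => by
    rw [Finset.mem_Icc] at hh
    push_cast [Nat.cast_sub (show 1 ≤ 2 * h by omega)]
    rw [show 2 * (h : ℝ) * Real.pi / (2 * m) = h * Real.pi / m by field_simp]
    rw [one_div_mul_eq_div, mul_div_mul_left _ _ two_ne_zero]
  rw [Finset.prod_congr rfl h4] at h3
  push_cast at h2 h3 ⊢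
  rw [h2, h3]
  ring

/-- The reflected family has one even mode more than odd ones, so a vector factor survives all
contractions. -/
theorem modeSum_high_of_odd_of_odd {n m : ℕ} (h : n < m) (hm : Odd m) (hn : Odd n) :
    modeSum m (fun i : Fin n => (m : ℤ) - ((i : ℤ) + 1)) = 0 :=
  modeSum_eq_zero_of_card (by omega) hn _ (high_mem h) (card_filter_even_sub_of_odd n hm)

/-! ### The common factor in terms of the lowest modes -/

/-- The eigenvalue of the dominating mode. -/
noncomputable def topEigenvalue (n m : ℕ) : ℝ :=
  2 * Real.sin (n * Real.pi / (2 * m)) * Real.cos ((n + 1) * Real.pi / (2 * m)) /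
      Real.sin (Real.pi / (2 * m))

/-- The sines of η are the determinant of the lowest modes by `det_sineMode`, and those of t ± h are
their `modeSum` times 2^n P by `prod_lowest_modes`. The last factor is 1/Q, so multiplying by Q
leaves the contribution of the lowest modes. -/
theorem commonFactorC_eq {n m : ℕ} (h : n < m) (η : Fin n → ℤ) (k : ℕ) :
    commonFactorC n m η k = (2 / m) ^ n * topEigenvalue n m ^ k *
      (Matrix.of fun i j : Fin n => sineMode m ((i : ℤ) + 1) (η j)).det *
      (modeSum m fun i : Fin n => (i : ℤ) + 1) * (2 ^ n ^ 2 * absSineProductC n m) := by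
  have h1 := prod_lowest_modes m n h
  rw [modeSum_eq_of_card h _ (low_mem h) (card_filter_even_succ n), det_sineMode, commonFactorC,
    ← topEigenvalue]
  have hI : ∀ (x y : ℝ), Real.sin (Real.pi * x / (2 * m)) = Real.sin (x * Real.pi / (2 * m)) :=
    fun x _ => by rw [mul_comm]
  have e1 : (2 : ℝ) ^ (2 * (n : ℤ) ^ 2 - n) = 2 ^ (n * (n - 1)) * 2 ^ n ^ 2 := by
    rw [← pow_add, ← zpow_natCast]
    congr 1
    rcases n with _ | n
    · simp
    · push_cast [add_tsub_cancel_right]; ring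
  have e2 : ∏ h : Fin n, ∏ t ∈ Finset.Ioi h,
        Real.sin (Real.pi * (((t : ℕ) + 1 : ℝ) - ((h : ℕ) + 1)) / (2 * m)) =
      ∏ j ∈ Finset.range n, ∏ i ∈ Finset.range j, Real.sin ((j - i : ℕ) * (Real.pi / (2 * m))) := by
    rw [prod_prod_Ioi_eq_prod_range n fun h t =>
      Real.sin (Real.pi * (((t : ℕ) + 1 : ℝ) - ((h : ℕ) + 1)) / (2 * m))]
    refine Finset.prod_congr rfl fun j _ => Finset.prod_congr rfl fun i hi => ?_
    rw [Finset.mem_range] at hi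
    push_cast [Nat.cast_sub hi.le]
    congr 1
    ring
  have e3 : ∏ h : Fin n, ∏ t ∈ Finset.Ici h,
        Real.sin (Real.pi * (((t : ℕ) + 1 : ℝ) + ((h : ℕ) + 1)) / (2 * m)) =
      (∏ j ∈ Finset.range n, Real.sin ((2 * (j + 1) : ℕ) * (Real.pi / (2 * m)))) *
      ∏ j ∈ Finset.range n, ∏ i ∈ Finset.range j,
        Real.sin ((j + i + 2 : ℕ) * (Real.pi / (2 * m))) := by
    have : ∀ h : Fin n, ∏ t ∈ Finset.Ici h,
        Real.sin (Real.pi * (((t : ℕ) + 1 : ℝ) + ((h : ℕ) + 1)) / (2 * m)) =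
        Real.sin ((2 * (h + 1) : ℕ) * (Real.pi / (2 * m))) * ∏ t ∈ Finset.Ioi h,
        Real.sin (Real.pi * (((t : ℕ) + 1 : ℝ) + ((h : ℕ) + 1)) / (2 * m)) := fun i => by
      rw [← Finset.Ioi_insert, Finset.prod_insert (by simp)]
      congr 2
      push_cast
      ring
    simp only [this]
    rw [Finset.prod_mul_distrib, prod_prod_Ioi_eq_prod_range n fun h t =>
      Real.sin (Real.pi * (((t : ℕ) + 1 : ℝ) + ((h : ℕ) + 1)) / (2 * m)),
      Fin.prod_univ_eq_prod_range fun j => Real.sin ((2 * (j + 1) : ℕ) * (Real.pi / (2 * m)))]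
    congr 1
    refine Finset.prod_congr rfl fun j _ => Finset.prod_congr rfl fun i hi => ?_
    push_cast
    congr 1
    ring
  have e4 : ∀ i j : Fin n, Real.sin (Real.pi * ((η i : ℝ) - η j) / (2 * m)) =
      Real.sin ((η i - η j : ℤ) * Real.pi / (2 * m)) := fun i j => by
    push_cast
    rw [mul_comm]
  have e5 : ∀ i j : Fin n, Real.sin (Real.pi * ((η j : ℝ) + η i) / (2 * m)) =
      Real.sin ((η i + η j : ℤ) * Real.pi / (2 * m)) := fun i j => by
    push_cast
    rw [mul_comm, add_comm]
  simp only [Finset.prod_mul_distrib] at h1 ⊢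
  simp only [e1, e2, e3, e4, e5, div_pow]
  linear_combination (-(2 ^ (n * (n - 1)) * 2 ^ n ^ 2 * topEigenvalue n m ^ k / (m : ℝ) ^ n *
    (∏ i, ∏ j ∈ Finset.Ioi i, Real.sin ((η i - η j : ℤ) * Real.pi / (2 * m))) *
    ∏ i, ∏ j ∈ Finset.Ici i, Real.sin ((η i + η j : ℤ) * Real.pi / (2 * m)))) * h1

/-! ### The number of walks -/

theorem mem_alcoveC_iff {n m : ℕ} {η : Fin n → ℤ} :
    (fun i => (η i : ℝ)) ∈ alcoveC n (m : ℝ) ↔ (∀ i, 0 < η i ∧ η i < m) ∧ StrictAnti η := by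
  have h1 : ∀ i, ((0 : ℝ) < η i ∧ (η i : ℝ) < m) ↔ (0 < η i ∧ η i < m) := fun i => by
    rw [Int.cast_pos, ← Int.cast_natCast (R := ℝ) m, Int.cast_lt]
  have h2 : StrictAnti (fun i => (η i : ℝ)) ↔ StrictAnti η := by
    simp [StrictAnti]
  rw [alcoveC, Set.mem_ofPred_eq, h2, and_comm]
  simp only [h1]

theorem mem_alcoveC_iff_mem_strictAntiSeqs {n m : ℕ} {η : Fin n → ℤ} :
    (fun i => (η i : ℝ)) ∈ alcoveC n (m : ℝ) ↔ η ∈ strictAntiSeqs n (m - 1) := by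
  rw [mem_alcoveC_iff, mem_strictAntiSeqs_sub_one]

theorem numStandardWalksC_zero {n m : ℕ} {η : Fin n → ℤ}
    (h : (fun i => (η i : ℝ)) ∈ alcoveC n (m : ℝ)) : numStandardWalksC n m η 0 = 1 := by
  rw [numStandardWalksC, Set.ncard_eq_one]
  refine ⟨fun _ => η, ?_⟩
  ext w
  simp only [standardWalksC, Set.mem_ofPred_eq, Set.mem_singleton_iff]
  constructor
  · rintro ⟨h0, -, -⟩
    ext i
    rw [Fin.fin_one_eq_zero i, h0]
  · rintro rfl
    exact ⟨rfl, fun s => s.elim0, fun _ => h⟩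

theorem numStandardWalksC_eq_zero {n m : ℕ} {η : Fin n → ℤ} (k : ℕ)
    (h : (fun i => (η i : ℝ)) ∉ alcoveC n (m : ℝ)) : numStandardWalksC n m η k = 0 := by
  have : standardWalksC n m η k = ∅ :=
    Set.eq_empty_of_forall_notMem fun w ⟨h0, _, h2⟩ => h (h0 ▸ h2 0)
  rw [numStandardWalksC, this, Set.ncard_empty]

/-- The end point of the step from `η` which is described by a direction and a sign. -/
def stepC {n : ℕ} (η : Fin n → ℤ) (s : Fin n × Bool) : Fin n → ℤ :=
  Function.update η s.1 (η s.1 + if s.2 then 1 else -1)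

theorem isStandardStep_iff {n : ℕ} (x y : Fin n → ℤ) :
    IsStandardStep x y ↔ ∃ s, y = stepC x s := by
  have h1 : ∀ j, x + Pi.single j 1 = stepC x (j, true) := fun j => by
    ext i
    by_cases h : i = j
    · subst h; simp [stepC]
    · simp [stepC, h]
  have h2 : ∀ j, x - Pi.single j 1 = stepC x (j, false) := fun j => by
    ext i
    by_cases h : i = j
    · subst h; simp [stepC, sub_eq_add_neg]
    · simp [stepC, h]
  simp [IsStandardStep, h1, h2, Prod.exists, or_comm]

theorem stepC_injective {n : ℕ} (η : Fin n → ℤ) : Function.Injective (stepC η) := by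
  rintro ⟨i, a⟩ ⟨j, b⟩ h
  have h1 := congrFun h i
  by_cases hij : i = j
  · subst hij
    simp only [stepC, Function.update_self] at h1
    cases a <;> cases b <;> simp at h1 ⊢
  · simp only [stepC, Function.update_self, Function.update_of_ne hij] at h1
    cases a <;> simp at h1

theorem standardWalksC_succ {n m : ℕ} {η : Fin n → ℤ} (k : ℕ)
    (h : (fun i => (η i : ℝ)) ∈ alcoveC n (m : ℝ)) :
    standardWalksC n m η (k + 1) =
      (fun w : Fin (k + 1) → Fin n → ℤ => (Fin.cons η w : Fin (k + 2) → Fin n → ℤ)) ''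
        ⋃ s, standardWalksC n m (stepC η s) k := by
  ext w
  simp only [Set.mem_image, Set.mem_iUnion]
  constructor
  · rintro ⟨h0, h1, h2⟩
    obtain ⟨s, hs⟩ := (isStandardStep_iff _ _).1 (h1 0)
    refine ⟨fun i => w i.succ, ⟨s, ?_, fun i => h1 i.succ, fun i => h2 i.succ⟩, ?_⟩
    · rw [← h0]; exact hs
    · rw [← h0]; exact Fin.cons_self_tail w
  · rintro ⟨v, ⟨s, h0, h1, h2⟩, rfl⟩
    refine ⟨rfl, fun i => ?_, fun i => ?_⟩
    · induction i using Fin.cases with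
      | zero =>
        refine (isStandardStep_iff _ _).2 ⟨s, ?_⟩
        simpa using h0
      | succ i => simpa using h1 i
    · induction i using Fin.cases with
      | zero => simpa using h
      | succ i => simpa using h2 i

theorem numStandardWalksC_succ {n m : ℕ} {η : Fin n → ℤ} (k : ℕ)
    (h : (fun i => (η i : ℝ)) ∈ alcoveC n (m : ℝ)) :
    numStandardWalksC n m η (k + 1) = ∑ s, numStandardWalksC n m (stepC η s) k := by
  classical
  have hinj : Function.Injective
      (fun w : Fin (k + 1) → Fin n → ℤ => (Fin.cons η w : Fin (k + 2) → Fin n → ℤ)) :=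
    fun a b hab => funext fun i => by simpa using congrFun hab i.succ
  rw [numStandardWalksC, standardWalksC_succ k h, Set.ncard_image_of_injective _ hinj]
  have : (⋃ s, standardWalksC n m (stepC η s) k) =
      ((Finset.univ.biUnion fun s => (standardWalksC_finite n m (stepC η s) k).toFinset :
        Finset _) : Set (Fin (k + 1) → Fin n → ℤ)) := by
    ext; simp
  rw [this, Set.ncard_coe_finset, Finset.card_biUnion]
  · refine Finset.sum_congr rfl fun s _ => ?_
    rw [numStandardWalksC, Set.ncard_eq_toFinset_card _ (standardWalksC_finite n m (stepC η s) k)]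
  · intro s _ t _ hst
    rw [Function.onFun, Finset.disjoint_left]
    intro w hw hw'
    rw [Set.Finite.mem_toFinset] at hw hw'
    exact hst (stepC_injective η (hw.1.symm.trans hw'.1))

/-! ### Orthogonality of the modes -/

theorem sum_Icc_eq_sum_range (f : ℤ → ℝ) (M : ℕ) :
    ∑ t ∈ Finset.Icc (1 : ℤ) M, f t = ∑ y ∈ Finset.range M, f (y + 1) := by
  refine (Finset.sum_bij (fun (y : ℕ) _ => (y : ℤ) + 1) ?_ ?_ ?_ fun _ _ => rfl).symm
  · intro y hy
    rw [Finset.mem_range] at hy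
    rw [Finset.mem_Icc]
    omega
  · intro a _ b _ h
    omega
  · intro t ht
    rw [Finset.mem_Icc] at ht
    exact ⟨(t - 1).toNat, by rw [Finset.mem_range]; omega, by omega⟩

theorem two_mul_sin_mul_sum_cos (a : ℝ) (M : ℕ) :
    2 * Real.sin a * ∑ y ∈ Finset.range M, Real.cos (2 * a * (y + 1)) =
      Real.sin ((2 * M + 1) * a) - Real.sin a := by
  induction M with
  | zero => simp
  | succ M ih =>
    rw [Finset.sum_range_succ, mul_add, ih,
      show (2 * ((M + 1 : ℕ) : ℝ) + 1) * a = 2 * a * (M + 1) + a by push_cast; ring,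
      show (2 * (M : ℝ) + 1) * a = 2 * a * (M + 1) - a by ring, Real.sin_add, Real.sin_sub]
    ring

theorem sum_modeCos_mul {m : ℕ} (hm : 0 < m) {c : ℤ} (hc : Real.sin (c * Real.pi / (2 * m)) ≠ 0) :
    ∑ y ∈ Finset.range (m - 1), Real.cos (c * (y + 1) * Real.pi / m) =
      -(1 + Real.cos (c * Real.pi)) / 2 := by
  have hm' : (m : ℝ) ≠ 0 := by positivity
  have h := two_mul_sin_mul_sum_cos (c * Real.pi / (2 * m)) (m - 1)
  have h1 : (2 * ((m - 1 : ℕ) : ℝ) + 1) * (c * Real.pi / (2 * m)) =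
      c * Real.pi - c * Real.pi / (2 * m) := by
    push_cast [Nat.cast_sub (Nat.succ_le_of_lt hm)]
    field_simp
    ring
  have h2 : ∀ y : ℕ, 2 * (c * Real.pi / (2 * m)) * ((y : ℝ) + 1) = c * (y + 1) * Real.pi / m :=
    fun y => by field_simp
  rw [h1, Real.sin_sub, Real.sin_int_mul_pi] at h
  simp only [h2] at h
  apply mul_left_cancel₀ (mul_ne_zero two_ne_zero hc)
  rw [h]
  ring

theorem sum_sineMode_mul_sineMode {m : ℕ} {a b : ℤ} (ha : 0 < a ∧ a < m) (hb : 0 < b ∧ b < m) :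
    ∑ t ∈ Finset.Icc (1 : ℤ) (m - 1 : ℕ), sineMode m t a * sineMode m t b =
      if a = b then (m : ℝ) / 2 else 0 := by
  have hm : 0 < m := by omega
  have h1 : ∀ y : ℕ, sineMode m ((y : ℤ) + 1) a * sineMode m ((y : ℤ) + 1) b =
      (Real.cos ((a - b : ℤ) * (y + 1) * Real.pi / m) -
        Real.cos ((a + b : ℤ) * (y + 1) * Real.pi / m)) / 2 := fun y => by
    rw [sineMode, sineMode]
    have e1 : ((a - b : ℤ) : ℝ) * (y + 1) * Real.pi / m =
      (((y : ℤ) + 1 : ℤ) : ℝ) * a * Real.pi / m - (((y : ℤ) + 1 : ℤ) : ℝ) * b * Real.pi / m := by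
      push_cast; ring
    have e2 : ((a + b : ℤ) : ℝ) * (y + 1) * Real.pi / m =
      (((y : ℤ) + 1 : ℤ) : ℝ) * a * Real.pi / m + (((y : ℤ) + 1 : ℤ) : ℝ) * b * Real.pi / m := by
      push_cast; ring
    rw [e1, e2, Real.cos_add, Real.cos_sub]
    ring
  rw [sum_Icc_eq_sum_range]
  simp only [h1]
  rw [← Finset.sum_div, Finset.sum_sub_distrib, sum_modeCos_mul hm (c := a + b)
    (sin_pos_of_lt (by omega) (by omega)).ne']
  split_ifs with hab
  · subst hab
    rw [cos_int_mul_pi_of_even ⟨a, rfl⟩]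
    simp [Nat.cast_sub (Nat.succ_le_of_lt hm)]
  · have hne : Real.sin ((a - b : ℤ) * Real.pi / (2 * m)) ≠ 0 := by
      rcases lt_or_gt_of_ne hab with h | h
      · have := sin_pos_of_lt (m := m) (r := b - a) (by omega) (by omega)
        have e : ((a - b : ℤ) : ℝ) * Real.pi / (2 * m) = -((b - a : ℤ) * Real.pi / (2 * m)) := by
          push_cast; ring
        rw [e, Real.sin_neg, neg_ne_zero]
        exact this.ne'
      · exact (sin_pos_of_lt (by omega) (by omega)).ne'
    rw [sum_modeCos_mul hm hne]
    -- As a+b and a-b have equal parity, the two cosine sums coincide and cancel.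
    have : ((a + b : ℤ) : ℝ) * Real.pi = (a - b : ℤ) * Real.pi + b * (2 * Real.pi) := by
      push_cast; ring
    rw [this, Real.cos_add_int_mul_two_pi]
    ring

/-- A strictly decreasing sequence is determined by its range, so for y ≠ x some value of y is
missed by x and gives a zero column. -/
theorem det_ite_eq {n : ℕ} {x y : Fin n → ℤ} (hx : StrictAnti x) (hy : StrictAnti y) :
    (Matrix.of fun i j => if x i = y j then (1 : ℝ) else 0).det = if y = x then 1 else 0 := by
  split_ifs with h
  · subst h
    rw [← Matrix.det_one (n := Fin n)]
    congr 1
    ext i j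
    simp [Matrix.one_apply, hx.injective.eq_iff]
  · by_contra hdet
    apply h
    have hsub : Set.range y ⊆ Set.range x := by
      rintro _ ⟨j, rfl⟩
      by_contra hj
      refine hdet (Matrix.det_eq_zero_of_column_eq_zero j fun i => ?_)
      rw [Matrix.of_apply, if_neg]
      exact fun hi => hj ⟨i, hi⟩
    have hr : Set.range y = Set.range x := by
      apply Set.eq_of_subset_of_ncard_le hsub _ (Set.finite_range x)
      rw [← Set.image_univ, ← Set.image_univ, Set.ncard_image_of_injective _ hx.injective,
        Set.ncard_image_of_injective _ hy.injective]
    exact (hy.range_inj hx).1 hr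

/-! ### The spectral formula -/

/-- All families of `n` modes. -/
noncomputable def modeFamilies (n m : ℕ) : Finset (Fin n → ℤ) :=
  Fintype.piFinset fun _ => Finset.Icc (1 : ℤ) (m - 1 : ℕ)

/-- The eigenvalue of a family of modes. -/
noncomputable def modeEigenvalue {n : ℕ} (m : ℕ) (r : Fin n → ℤ) : ℝ := ∑ i, 2 * modeCos m (r i)

/-- The contribution of a family of modes to the number of walks. -/
noncomputable def modeTerm {n : ℕ} (m : ℕ) (η r : Fin n → ℤ) : ℝ :=
  (∏ i, sineMode m (r i) (η i)) * modeSum m r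

/-- The case k = 0 of the spectral formula. Expanding the determinant over permutations makes the
sum over `r` factor into one-dimensional orthogonality relations. -/
theorem sum_modeTerm {n m : ℕ} {η : Fin n → ℤ} (hη : η ∈ strictAntiSeqs n (m - 1)) :
    ∑ r ∈ modeFamilies n m, modeTerm m η r = (m / 2 : ℝ) ^ n := by
  have key : ∀ x ∈ strictAntiSeqs n (m - 1), ∑ r ∈ modeFamilies n m,
      (∏ i, sineMode m (r i) (η i)) * (Matrix.of fun i j => sineMode m (r i) (x j)).det =
      if x = η then (m / 2 : ℝ) ^ n else 0 := by
    intro x hx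
    rw [mem_strictAntiSeqs_sub_one] at hx hη
    have h1 : ∀ r : Fin n → ℤ, (∏ i, sineMode m (r i) (η i)) *
        (Matrix.of fun i j => sineMode m (r i) (x j)).det =
        ∑ σ : Equiv.Perm (Fin n), (σ.sign : ℤ) *
          ∏ i, sineMode m (r i) (η i) * sineMode m (r i) (x (σ i)) := fun r => by
      rw [← Matrix.det_transpose, Matrix.det_apply', Finset.mul_sum]
      refine Finset.sum_congr rfl fun σ _ => ?_
      rw [Finset.prod_mul_distrib]
      simp only [Matrix.transpose_apply, Matrix.of_apply]
      ring
    simp only [h1]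
    rw [Finset.sum_comm]
    simp only [← Finset.mul_sum, modeFamilies]
    have h2 : ∀ σ : Equiv.Perm (Fin n),
        ∑ r ∈ Fintype.piFinset fun _ : Fin n => Finset.Icc (1 : ℤ) (m - 1 : ℕ),
          ∏ i, sineMode m (r i) (η i) * sineMode m (r i) (x (σ i)) =
        ∏ i, (m / 2 : ℝ) * if η i = x (σ i) then 1 else 0 := fun σ => by
      rw [← Finset.prod_univ_sum (fun _ : Fin n => Finset.Icc (1 : ℤ) (m - 1 : ℕ))
        fun i t => sineMode m t (η i) * sineMode m t (x (σ i))]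
      refine Finset.prod_congr rfl fun i _ => ?_
      rw [sum_sineMode_mul_sineMode (hη.1 i) (hx.1 _)]
      split_ifs <;> simp
    simp only [h2]
    simp only [Finset.prod_mul_distrib, Finset.prod_const, Finset.card_univ, Fintype.card_fin]
    have h3 := det_ite_eq hη.2 hx.2
    rw [← Matrix.det_transpose, Matrix.det_apply'] at h3
    simp only [Matrix.transpose_apply, Matrix.of_apply] at h3
    simp only [mul_left_comm _ ((m / 2 : ℝ) ^ n)]
    rw [← Finset.mul_sum, h3]
    split_ifs <;> simp
  simp only [modeTerm, modeSum, Finset.mul_sum]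
  rw [Finset.sum_comm, Finset.sum_congr rfl key, Finset.sum_ite_eq', if_pos hη]

/-- Exchanging the modes at i and j preserves the eigenvalue and, as η i = η j, the product of
sines, but negates `modeSum`. -/
theorem sum_pow_mul_modeTerm_eq_zero_of_eq {n m : ℕ} {η : Fin n → ℤ} (k : ℕ) {i j : Fin n}
    (hij : i ≠ j) (h : η i = η j) :
    ∑ r ∈ modeFamilies n m, modeEigenvalue m r ^ k * modeTerm m η r = 0 := by
  have hη : ∀ l, η (Equiv.swap i j l) = η l := fun l => by
    rw [Equiv.swap_apply_def]
    split_ifs with h1 h2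
    · rw [h1, h]
    · rw [h2, h]
    · rfl
  have hsum : ∑ r ∈ modeFamilies n m, modeEigenvalue m r ^ k * modeTerm m η r =
      ∑ r ∈ modeFamilies n m, -(modeEigenvalue m r ^ k * modeTerm m η r) := by
    refine Finset.sum_nbij' (fun r l => r (Equiv.swap i j l)) (fun r l => r (Equiv.swap i j l))
      ?_ ?_ ?_ ?_ ?_
    · intro r hr
      rw [modeFamilies, Fintype.mem_piFinset] at hr ⊢
      exact fun l => hr _
    · intro r hr
      rw [modeFamilies, Fintype.mem_piFinset] at hr ⊢
      exact fun l => hr _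
    · intro r _
      simp
    · intro r _
      simp
    · intro r _
      have e1 : modeEigenvalue m (fun l => r (Equiv.swap i j l)) = modeEigenvalue m r :=
        Equiv.sum_comp (Equiv.swap i j) fun l => 2 * modeCos m (r l)
      have e2 : ∏ l, sineMode m (r (Equiv.swap i j l)) (η l) = ∏ l, sineMode m (r l) (η l) := by
        have := Equiv.prod_comp (Equiv.swap i j) fun l => sineMode m (r l) (η l)
        simpa only [hη] using this
      rw [e1, modeTerm, modeTerm, e2, modeSum_comp_perm, Equiv.Perm.sign_swap hij]
      simp
  rw [Finset.sum_neg_distrib] at hsum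
  linarith

theorem sum_pow_mul_modeTerm_eq_zero_of_wall {n m : ℕ} {η : Fin n → ℤ} (k : ℕ) {i : Fin n}
    (h : η i = 0 ∨ η i = m) :
    ∑ r ∈ modeFamilies n m, modeEigenvalue m r ^ k * modeTerm m η r = 0 := by
  refine Finset.sum_eq_zero fun r _ => ?_
  rw [modeTerm, Finset.prod_eq_zero (Finset.mem_univ i), zero_mul, mul_zero]
  rw [sineMode]
  rcases h with h | h
  · simp [h]
  · rw [h]
    rcases Nat.eq_zero_or_pos m with rfl | hm
    · simp
    · have : (m : ℝ) ≠ 0 := by positivity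
      rw [← Real.sin_int_mul_pi (r i)]
      congr 1
      push_cast
      field_simp

theorem sum_stepC_modeTerm {n m : ℕ} (η r : Fin n → ℤ) :
    ∑ s, modeTerm m (stepC η s) r = modeEigenvalue m r * modeTerm m η r := by
  rw [Fintype.sum_prod_type, modeEigenvalue, Finset.sum_mul]
  refine Finset.sum_congr rfl fun j _ => ?_
  have h : ∀ v, ∏ i, sineMode m (r i) (Function.update η j v i) =
      sineMode m (r j) v * ∏ i ∈ Finset.univ.erase j, sineMode m (r i) (η i) := fun v => by
    rw [← Finset.mul_prod_erase _ _ (Finset.mem_univ j), Function.update_self]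
    congr 1
    refine Finset.prod_congr rfl fun i hi => ?_
    rw [Function.update_of_ne (Finset.ne_of_mem_erase hi)]
  have h2 := h (η j)
  rw [Function.update_eq_self] at h2
  have h3 : sineMode m (r j) (η j + 1) + sineMode m (r j) (η j + -1) =
      2 * modeCos m (r j) * sineMode m (r j) (η j) := by
    rw [sineMode, sineMode, sineMode, modeCos]
    have e1 : (r j : ℝ) * ((η j + 1 : ℤ) : ℝ) * Real.pi / m =
        r j * η j * Real.pi / m + r j * Real.pi / m := by push_cast; ring
    have e2 : (r j : ℝ) * ((η j + -1 : ℤ) : ℝ) * Real.pi / m =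
        r j * η j * Real.pi / m - r j * Real.pi / m := by push_cast; ring
    rw [e1, e2, Real.sin_add, Real.sin_sub]
    ring
  simp only [modeTerm, Fintype.sum_bool, stepC, if_true, h, h2]
  simp only [Bool.false_eq_true, if_false]
  linear_combination (∏ i ∈ Finset.univ.erase j, sineMode m (r i) (η i)) * modeSum m r * h3

/-- A single coordinate moves by one, so a step cannot jump over a wall without landing on it. -/
theorem stepC_mem_or_wall {n m : ℕ} {η : Fin n → ℤ} (hη : η ∈ strictAntiSeqs n (m - 1))
    (s : Fin n × Bool) : stepC η s ∈ strictAntiSeqs n (m - 1) ∨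
      (∃ i j, i ≠ j ∧ stepC η s i = stepC η s j) ∨ ∃ i, stepC η s i = 0 ∨ stepC η s i = m := by
  by_cases h1 : ∃ i j, i ≠ j ∧ stepC η s i = stepC η s j
  · exact Or.inr (Or.inl h1)
  by_cases h2 : ∃ i, stepC η s i = 0 ∨ stepC η s i = m
  · exact Or.inr (Or.inr h2)
  left
  push Not at h1 h2
  rw [mem_strictAntiSeqs_sub_one] at hη ⊢
  have hb : ∀ i, η i - 1 ≤ stepC η s i ∧ stepC η s i ≤ η i + 1 ∧
      (i ≠ s.1 → stepC η s i = η i) := fun i => by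
    by_cases hi : i = s.1
    · subst hi
      simp only [stepC, Function.update_self]
      split_ifs <;> refine ⟨by omega, by omega, fun h => absurd rfl h⟩
    · rw [stepC, Function.update_of_ne hi]
      exact ⟨by omega, by omega, fun _ => rfl⟩
  refine ⟨fun i => ?_, fun i j hij => ?_⟩
  · have := hb i
    have := h2 i
    have := hη.1 i
    omega
  · have a1 := hb i
    have a2 := hb j
    have a3 := h1 i j hij.ne
    have a4 := hη.2 hij
    by_cases hi : i = s.1
    · have := a2.2.2 (hi ▸ hij.ne')
      omega
    · have := a1.2.2 hi
      omega

/-- The spectral formula for the number of walks. -/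
theorem numStandardWalksC_eq {n m : ℕ} (hm : 0 < m) (k : ℕ) {η : Fin n → ℤ}
    (hη : η ∈ strictAntiSeqs n (m - 1)) :
    (numStandardWalksC n m η k : ℝ) =
      (2 / m : ℝ) ^ n * ∑ r ∈ modeFamilies n m, modeEigenvalue m r ^ k * modeTerm m η r := by
  induction k generalizing η with
  | zero =>
    rw [numStandardWalksC_zero (mem_alcoveC_iff_mem_strictAntiSeqs.2 hη)]
    simp only [pow_zero, one_mul]
    have : (m : ℝ) ≠ 0 := by positivity
    rw [sum_modeTerm hη, ← mul_pow, div_mul_div_cancel₀ this]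
    simp
  | succ k ih =>
    rw [numStandardWalksC_succ k (mem_alcoveC_iff_mem_strictAntiSeqs.2 hη), Nat.cast_sum]
    -- The induction hypothesis covers end points in the alcove; any other lies on a wall, where
    -- both sides are zero.
    have : ∀ s, (numStandardWalksC n m (stepC η s) k : ℝ) = (2 / m : ℝ) ^ n *
        ∑ r ∈ modeFamilies n m, modeEigenvalue m r ^ k * modeTerm m (stepC η s) r := fun s => by
      rcases stepC_mem_or_wall hη s with h | h
      · exact ih h
      · rw [numStandardWalksC_eq_zero, Nat.cast_zero]
        · rcases h with ⟨i, j, hij, h⟩ | ⟨i, h⟩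
          · rw [sum_pow_mul_modeTerm_eq_zero_of_eq k hij h, mul_zero]
          · rw [sum_pow_mul_modeTerm_eq_zero_of_wall k h, mul_zero]
        · rw [mem_alcoveC_iff]
          rintro ⟨h1, h2⟩
          rcases h with ⟨i, j, hij, h⟩ | ⟨i, h⟩
          · exact hij (h2.injective h)
          · have := h1 i
            omega
    simp only [this]
    rw [← Finset.mul_sum, Finset.sum_comm]
    congr 1
    refine Finset.sum_congr rfl fun r _ => ?_
    rw [← Finset.mul_sum, sum_stepC_modeTerm]
    ring

/-! ### The dominating modes -/

theorem modeCos_lt_of_lt {m : ℕ} {a b : ℤ} (ha : 0 < a) (hab : a < b) (hb : b < m) :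
    modeCos m b < modeCos m a := by
  have := modeCos_sub m a b
  have h1 := sin_pos_of_lt (m := m) (r := b + a) (by omega) (by omega)
  have h2 := sin_pos_of_lt (m := m) (r := b - a) (by omega) (by omega)
  have : 0 < modeCos m a - modeCos m b := by rw [this]; positivity
  linarith

/-- The cosine decreases along the modes. Those of `R` beyond n are as many as the missing ones
among 1, …, n, and the cosine of mode n separates the two groups. -/
theorem sum_modeCos_lt {n m : ℕ} (hn : 0 < n) (h : n < m) {R : Finset ℤ}
    (hR : ∀ a ∈ R, 0 < a ∧ a < m) (hc : R.card = n) (hne : ∃ a ∈ R, (n : ℤ) < a) :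
    ∑ a ∈ R, modeCos m a < ∑ a ∈ Finset.Icc (1 : ℤ) n, modeCos m a := by
  set I := Finset.Icc (1 : ℤ) n with hI
  have hcI : I.card = n := by simp [hI]
  have hcard : (R \ I).card = (I \ R).card :=
    Finset.card_sdiff_comm (hc.trans hcI.symm)
  rw [← Finset.sum_inter_add_sum_sdiff R I, ← Finset.sum_inter_add_sum_sdiff I R,
    Finset.inter_comm I R]
  have h1 : ∑ a ∈ R \ I, modeCos m a < (R \ I).card • modeCos m n := by
    rw [← Finset.sum_const]
    apply Finset.sum_lt_sum_of_nonempty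
    · obtain ⟨a, ha, ha'⟩ := hne
      exact ⟨a, by simp only [hI, Finset.mem_sdiff, Finset.mem_Icc]; exact ⟨ha, by omega⟩⟩
    · intro a ha
      simp only [hI, Finset.mem_sdiff, Finset.mem_Icc] at ha
      have := hR a ha.1
      exact modeCos_lt_of_lt (by omega) (by omega) this.2
  have h2 : (I \ R).card • modeCos m n ≤ ∑ a ∈ I \ R, modeCos m a := by
    apply Finset.card_nsmul_le_sum
    intro a ha
    simp only [hI, Finset.mem_sdiff, Finset.mem_Icc] at ha
    rcases eq_or_lt_of_le ha.1.2 with h' | h'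
    · rw [h']
    · exact (modeCos_lt_of_lt (by omega) h' (by omega)).le
  rw [hcard] at h1
  linarith

/-- The family of the modes `1, …, n`. -/
def lowModes (n : ℕ) : Fin n → ℤ := fun i => (i : ℤ) + 1

/-- The family of the modes `m - 1, …, m - n`. -/
def highModes (n m : ℕ) : Fin n → ℤ := fun i => (m : ℤ) - ((i : ℤ) + 1)

theorem lowModes_injective (n : ℕ) : Function.Injective (lowModes n) := fun i j h => by
  simp only [lowModes] at h
  omega

theorem highModes_injective (n m : ℕ) : Function.Injective (highModes n m) := fun i j h => by
  simp only [highModes] at h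
  omega

theorem modeEigenvalue_lowModes (n m : ℕ) :
    modeEigenvalue m (lowModes n) = 2 * ∑ a ∈ Finset.Icc (1 : ℤ) n, modeCos m a := by
  rw [sum_Icc_eq_sum_range, modeEigenvalue, Finset.mul_sum]
  exact Fin.sum_univ_eq_sum_range (fun i => 2 * modeCos m ((i : ℤ) + 1)) n

theorem modeEigenvalue_lowModes_eq_topEigenvalue {n m : ℕ} (h : n < m) :
    modeEigenvalue m (lowModes n) = topEigenvalue n m := by
  have hs : Real.sin (Real.pi / (2 * m)) ≠ 0 := by
    have := sin_nat_mul_pos (k := 1) (m := m) one_pos (by omega)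
    rw [Nat.cast_one, one_mul] at this
    exact this.ne'
  have h2 := two_mul_sin_mul_sum_cos (Real.pi / (2 * m)) n
  rw [modeEigenvalue_lowModes, sum_Icc_eq_sum_range, topEigenvalue, eq_div_iff hs]
  have h3 : ∀ y : ℕ, Real.cos (2 * (Real.pi / (2 * m)) * (y + 1)) = modeCos m ((y : ℤ) + 1) :=
    fun y => by
    rw [modeCos]
    congr 1
    push_cast
    field_simp
  simp only [h3] at h2
  have e1 : (n : ℝ) * Real.pi / (2 * m) = n * (Real.pi / (2 * m)) := by ring
  have e2 : ((n : ℝ) + 1) * Real.pi / (2 * m) = n * (Real.pi / (2 * m)) + Real.pi / (2 * m) := by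
    ring
  have e3 : (2 * (n : ℝ) + 1) * (Real.pi / (2 * m)) =
    n * (Real.pi / (2 * m)) + (n * (Real.pi / (2 * m)) + Real.pi / (2 * m)) := by ring
  rw [e3] at h2
  rw [e1, e2, mul_right_comm, h2]
  generalize (n : ℝ) * (Real.pi / (2 * m)) = x
  generalize Real.pi / (2 * (m : ℝ)) = y
  have h4 : Real.sin y = Real.sin (x + y) * Real.cos x - Real.cos (x + y) * Real.sin x := by
    rw [← Real.sin_sub]; congr 1; ring
  rw [Real.sin_add x (x + y)]
  linear_combination (-1) * h4

theorem modeEigenvalue_sub_left {n m : ℕ} (hm : 0 < m) (r : Fin n → ℤ) :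
    modeEigenvalue m (fun i => (m : ℤ) - r i) = -modeEigenvalue m r := by
  simp [modeEigenvalue, modeCos_sub_left hm]

theorem modeEigenvalue_comp_perm {n : ℕ} (m : ℕ) (r : Fin n → ℤ) (σ : Equiv.Perm (Fin n)) :
    modeEigenvalue m (fun i => r (σ i)) = modeEigenvalue m r :=
  Equiv.sum_comp σ fun i => 2 * modeCos m (r i)

theorem eq_lowModes_or_modeEigenvalue_lt {n m : ℕ} (hn : 0 < n) (h : n < m) {r : Fin n → ℤ}
    (hr : ∀ i, 0 < r i ∧ r i < m) (hinj : Function.Injective r) :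
    (∃ σ : Equiv.Perm (Fin n), r = fun i => lowModes n (σ i)) ∨
      modeEigenvalue m r < topEigenvalue n m := by
  by_cases hle : ∀ i, r i ≤ n
  · left
    let f : Fin n → Fin n := fun i => ⟨(r i - 1).toNat, by have := hr i; have := hle i; omega⟩
    have hf : Function.Injective f := fun i j hij => by
      have h1 := hr i
      have h2 := hr j
      simp only [f, Fin.mk.injEq] at hij
      exact hinj (by omega)
    refine ⟨Equiv.ofBijective f (Finite.injective_iff_bijective.1 hf), funext fun i => ?_⟩
    have h1 := hr i
    simp only [lowModes, Equiv.ofBijective_apply, f]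
    omega
  · right
    push Not at hle
    obtain ⟨i, hi⟩ := hle
    have := sum_modeCos_lt hn h (R := Finset.univ.image r) (by simpa using hr)
      (by rw [Finset.card_image_of_injective _ hinj]; simp) ⟨r i, by simp, hi⟩
    rw [Finset.sum_image fun _ _ _ _ hij => hinj hij] at this
    rw [← modeEigenvalue_lowModes_eq_topEigenvalue h, modeEigenvalue_lowModes, modeEigenvalue,
      ← Finset.mul_sum]
    linarith

theorem mem_modeFamilies {n m : ℕ} {r : Fin n → ℤ} :
    r ∈ modeFamilies n m ↔ ∀ i, 0 < r i ∧ r i < m := by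
  rw [modeFamilies, Fintype.mem_piFinset]
  refine forall_congr' fun i => ?_
  rw [Finset.mem_Icc]
  omega

theorem modeTerm_eq_zero {n m : ℕ} (η : Fin n → ℤ) {r : Fin n → ℤ} (h : ¬ Function.Injective r) :
    modeTerm m η r = 0 := by
  simp only [Function.Injective, not_forall] at h
  obtain ⟨i, j, hij, hne⟩ := h
  rw [modeTerm, modeSum, Finset.sum_eq_zero, mul_zero]
  intro x _
  refine Matrix.det_zero_of_row_eq hne ?_
  ext l
  simp [hij]

/-- The upper bound for eigenvalues is applied to `r` and to m - r, whose eigenvalue is the negative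
one; repeated modes contribute nothing. -/
theorem dominating_or_lt {n m : ℕ} (hn : 0 < n) (h : n < m) (η : Fin n → ℤ) {r : Fin n → ℤ}
    (hr : r ∈ modeFamilies n m) :
    (∃ σ : Equiv.Perm (Fin n), r = fun i => lowModes n (σ i)) ∨
      (∃ σ : Equiv.Perm (Fin n), r = fun i => highModes n m (σ i)) ∨
      modeTerm m η r = 0 ∨ |modeEigenvalue m r| < topEigenvalue n m := by
  rw [mem_modeFamilies] at hr
  by_cases hinj : Function.Injective r
  · rcases eq_lowModes_or_modeEigenvalue_lt hn h hr hinj with h1 | h1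
    · exact Or.inl h1
    rcases eq_lowModes_or_modeEigenvalue_lt hn h (r := fun i => (m : ℤ) - r i)
      (fun i => by have := hr i; omega) (fun i j hij => hinj (by simpa using hij)) with ⟨σ, h2⟩ | h2
    · refine Or.inr (Or.inl ⟨σ, funext fun i => ?_⟩)
      have := congrFun h2 i
      simp only [lowModes, highModes] at this ⊢
      omega
    · rw [modeEigenvalue_sub_left (by omega)] at h2
      exact Or.inr (Or.inr (Or.inr (abs_lt.2 ⟨by linarith, h1⟩)))
  · exact Or.inr (Or.inr (Or.inl (modeTerm_eq_zero η hinj)))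

theorem modeEigenvalue_highModes {n m : ℕ} (h : n < m) :
    modeEigenvalue m (highModes n m) = -topEigenvalue n m := by
  rw [← modeEigenvalue_lowModes_eq_topEigenvalue h, ← modeEigenvalue_sub_left (by omega)]
  rfl

/-- As `modeSum` is alternating, summing over the orbit of `r` turns the product of sines into a
determinant. -/
theorem sum_perm_modeTerm {n m : ℕ} (η r : Fin n → ℤ) (k : ℕ) :
    ∑ σ : Equiv.Perm (Fin n), modeEigenvalue m (fun i => r (σ i)) ^ k *
      modeTerm m η (fun i => r (σ i)) =
    modeEigenvalue m r ^ k *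
      ((Matrix.of fun i j => sineMode m (r i) (η j)).det * modeSum m r) := by
  rw [Matrix.det_apply', Finset.sum_mul, Finset.mul_sum]
  refine Finset.sum_congr rfl fun σ _ => ?_
  rw [modeEigenvalue_comp_perm, modeTerm, modeSum_comp_perm]
  simp only [Matrix.of_apply]
  ring

theorem sineMode_sub_left {m : ℕ} (hm : 0 < m) (a x : ℤ) :
    sineMode m (m - a) x = -(-1) ^ x * sineMode m a x := by
  have : (m : ℝ) ≠ 0 := by positivity
  rw [sineMode, sineMode]
  have h : ((m - a : ℤ) : ℝ) * x * Real.pi / m = x * Real.pi - a * x * Real.pi / m := by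
    push_cast
    field_simp
  rw [h, Real.sin_sub, Real.sin_int_mul_pi, Real.cos_int_mul_pi]
  ring

theorem det_highModes {n m : ℕ} (hm : 0 < m) (x : Fin n → ℤ) :
    (Matrix.of fun i j => sineMode m (highModes n m i) (x j)).det =
      (-1) ^ n * (-1) ^ (∑ i, x i) *
        (Matrix.of fun i j => sineMode m (lowModes n i) (x j)).det := by
  have h1 : (Matrix.of fun i j => sineMode m (highModes n m i) (x j)) =
      Matrix.of fun i j => (-(-1) ^ x j) *
        (Matrix.of fun i j => sineMode m (lowModes n i) (x j)) i j := by
    ext i j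
    exact sineMode_sub_left hm _ _
  have h2 : ∏ j, (-(-1 : ℝ) ^ x j) = (-1) ^ n * (-1) ^ (∑ i, x i) := by
    have h3 : ∀ s : Finset (Fin n), (-1 : ℝ) ^ (∑ i ∈ s, x i) = ∏ i ∈ s, (-1 : ℝ) ^ x i := fun s => by
      classical
      induction s using Finset.induction_on with
      | empty => simp
      | insert a s ha ih =>
        rw [Finset.sum_insert ha, Finset.prod_insert ha, zpow_add₀ (by norm_num), ih]
    rw [Finset.prod_neg, h3]
    simp
  rw [h1, Matrix.det_mul_row, h2]

/-- The points (n, n-1, …, 1) and (n+1, n-1, …, 1) have coordinate sums of opposite parity; the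
second needs n + 1 < m. -/
theorem exists_mem_strictAntiSeqs_sign {n m : ℕ} (hn : 0 < n) (h : n + 1 < m) (s : ℝ)
    (hs : s = 1 ∨ s = -1) :
    ∃ x ∈ strictAntiSeqs n (m - 1), (-1 : ℝ) ^ n * (-1) ^ (∑ i, x i) = s := by
  let x : Fin n → ℤ := fun i => (n : ℤ) - i
  let i0 : Fin n := ⟨0, hn⟩
  let y : Fin n → ℤ := Function.update x i0 (x i0 + 1)
  have hx : x ∈ strictAntiSeqs n (m - 1) := by
    rw [mem_strictAntiSeqs_sub_one]
    refine ⟨fun i => ?_, fun i j hij => ?_⟩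
    · have := i.2; simp only [x]; omega
    · have : (i : ℕ) < j := hij
      simp only [x]
      omega
  have hyi : ∀ i, y i = if i = i0 then x i + 1 else x i := fun i => by
    by_cases hi : i = i0
    · subst hi; simp [y]
    · simp [y, hi]
  have hy : y ∈ strictAntiSeqs n (m - 1) := by
    rw [mem_strictAntiSeqs_sub_one] at hx ⊢
    refine ⟨fun i => ?_, fun i j hij => ?_⟩
    · rw [hyi]
      have := i.2
      have := hx.1 i
      split_ifs with hi
      · subst hi; simp only [x, i0] at this ⊢; omega
      · exact this
    · rw [hyi, hyi, if_neg (show j ≠ i0 by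
        rintro rfl
        exact absurd (Fin.lt_def.1 hij) (by simp [i0]))]
      have := hx.2 hij
      split_ifs <;> omega
  have hsum : ∑ i, y i = ∑ i, x i + 1 := by
    simp only [y]
    rw [Finset.sum_update_of_mem (Finset.mem_univ _), ← Finset.add_sum_erase _ x (Finset.mem_univ i0),
      ← Finset.erase_eq]
    ring
  have hsgn : (-1 : ℝ) ^ n * (-1) ^ (∑ i, y i) = -((-1 : ℝ) ^ n * (-1) ^ (∑ i, x i)) := by
    rw [hsum, zpow_add₀ (by norm_num)]
    simp
  have hsq : ((-1 : ℝ) ^ n * (-1) ^ (∑ i, x i)) * ((-1 : ℝ) ^ n * (-1) ^ (∑ i, x i)) = 1 := by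
    rw [mul_mul_mul_comm, ← mul_pow, ← mul_zpow]
    simp
  rcases mul_self_eq_one_iff.1 hsq with h1 | h1 <;> rcases hs with rfl | rfl
  · exact ⟨x, hx, h1⟩
  · exact ⟨y, hy, by rw [hsgn, h1]⟩
  · exact ⟨y, hy, by rw [hsgn, h1, neg_neg]⟩
  · exact ⟨x, hx, h1⟩

/-- At each point the two determinants agree up to sign and the lowest one is positive, so every
summand is 0 or twice a positive number, and the latter occurs. -/
theorem modeSum_add_sign_mul_pos {n m : ℕ} (hn : 0 < n) (h : n + 1 < m) (s : ℝ)
    (hs : s = 1 ∨ s = -1) :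
    0 < modeSum m (lowModes n) + s * modeSum m (highModes n m) := by
  obtain ⟨x, hx, hxs⟩ := exists_mem_strictAntiSeqs_sign hn h s hs
  rw [modeSum, modeSum, Finset.mul_sum, ← Finset.sum_add_distrib]
  have hpos : ∀ y ∈ strictAntiSeqs n (m - 1),
      0 < (Matrix.of fun i j => sineMode m (lowModes n i) (y j)).det := fun y hy =>
    det_sineMode_pos y (mem_strictAntiSeqs_sub_one.1 hy).2 (mem_strictAntiSeqs_sub_one.1 hy).1
  refine Finset.sum_pos' (fun y hy => ?_) ⟨x, hx, ?_⟩
  · rw [det_highModes (by omega)]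
    have hsq : ((-1 : ℝ) ^ n * (-1) ^ (∑ i, y i)) * ((-1 : ℝ) ^ n * (-1) ^ (∑ i, y i)) = 1 := by
      rw [mul_mul_mul_comm, ← mul_pow, ← mul_zpow]
      simp
    have := hpos y hy
    rcases mul_self_eq_one_iff.1 hsq with h1 | h1 <;> rcases hs with rfl | rfl <;>
      rw [h1] <;> linarith
  · rw [det_highModes (by omega), hxs]
    have := hpos x hx
    rcases hs with rfl | rfl <;> linarith

/-! ### Asymptotics -/

theorem topEigenvalue_pos {n m : ℕ} (hn : 0 < n) (h : n + 1 < m) : 0 < topEigenvalue n m := by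
  rw [topEigenvalue]
  have h1 := sin_nat_mul_pos (k := n) (m := m) hn (by omega)
  have h2 := cos_nat_mul_pos (k := n + 1) (m := m) h
  have h3 := sin_nat_mul_pos (k := 1) (m := m) one_pos (by omega)
  rw [Nat.cast_one, one_mul] at h3
  push_cast at h2
  rw [← mul_div_assoc] at h1 h2
  positivity

theorem topEigenvalue_eq_zero {n m : ℕ} (h : n + 1 = m) : topEigenvalue n m = 0 := by
  have hm : (m : ℝ) ≠ 0 := by
    have : 0 < m := by omega
    positivity
  have : ((n : ℝ) + 1) * Real.pi / (2 * m) = Real.pi / 2 := by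
    rw [show (n : ℝ) + 1 = m by exact_mod_cast h]
    field_simp
  rw [topEigenvalue, this, Real.cos_pi_div_two]
  simp

/-- The alcove is then a single point. In the spectral formula the top eigenvalue is 0, so no
eigenvalue has smaller modulus and every term with k > 0 vanishes. -/
theorem numStandardWalksC_eq_zero_of_succ_eq {n m : ℕ} (hn : 0 < n) (h : n + 1 = m)
    {η : Fin n → ℤ} (hη : η ∈ strictAntiSeqs n (m - 1)) {k : ℕ} (hk : 0 < k) :
    (numStandardWalksC n m η k : ℝ) = 0 := by
  rw [numStandardWalksC_eq (by omega) k hη, Finset.sum_eq_zero, mul_zero]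
  intro r hr
  have h0 := topEigenvalue_eq_zero h
  rcases dominating_or_lt hn (by omega) η hr with ⟨σ, rfl⟩ | ⟨σ, rfl⟩ | h1 | h1
  · rw [modeEigenvalue_comp_perm, modeEigenvalue_lowModes_eq_topEigenvalue (by omega), h0,
      zero_pow hk.ne', zero_mul]
  · rw [modeEigenvalue_comp_perm, modeEigenvalue_highModes (by omega), h0, neg_zero,
      zero_pow hk.ne', zero_mul]
  · rw [h1, mul_zero]
  · rw [h0] at h1
    exact absurd h1 (abs_nonneg _).not_gt

theorem sum_image_perm {n : ℕ} {r : Fin n → ℤ} (hr : Function.Injective r)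
    (F : (Fin n → ℤ) → ℝ) :
    ∑ x ∈ Finset.univ.image (fun (σ : Equiv.Perm (Fin n)) i => r (σ i)), F x =
      ∑ σ : Equiv.Perm (Fin n), F fun i => r (σ i) :=
  Finset.sum_image fun _ _ _ _ h => Equiv.ext fun i => hr (congrFun h i)

/-- Only the lowest and the highest modes matter asymptotically. -/
theorem numStandardWalksC_sub_isLittleO {n m : ℕ} (hn : 0 < n) (h : n + 1 < m)
    {η : Fin n → ℤ} (hη : η ∈ strictAntiSeqs n (m - 1)) :
    (fun k : ℕ => (numStandardWalksC n m η k : ℝ) - (2 / m : ℝ) ^ n * topEigenvalue n m ^ k *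
      (Matrix.of fun i j => sineMode m (lowModes n i) (η j)).det *
      (modeSum m (lowModes n) + (-1) ^ k * ((-1) ^ n * (-1) ^ (∑ i, η i)) *
        modeSum m (highModes n m))) =o[atTop] fun k : ℕ => topEigenvalue n m ^ k := by
  classical
  let L : Finset (Fin n → ℤ) :=
    Finset.univ.image fun (σ : Equiv.Perm (Fin n)) i => lowModes n (σ i)
  let H : Finset (Fin n → ℤ) :=
    Finset.univ.image fun (σ : Equiv.Perm (Fin n)) i => highModes n m (σ i)
  have hLH : Disjoint L H := by
    rw [Finset.disjoint_left]
    intro r hL hH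
    simp only [L, H, Finset.mem_image, Finset.mem_univ, true_and] at hL hH
    obtain ⟨σ, rfl⟩ := hL
    obtain ⟨τ, hτ⟩ := hH
    -- This is the position of mode m-1, which exceeds n because n + 1 < m.
    have := congrFun hτ (τ.symm ⟨0, hn⟩)
    simp only [Equiv.apply_symm_apply, lowModes, highModes] at this
    have := (σ (τ.symm ⟨0, hn⟩)).2
    omega
  have hsub : L ∪ H ⊆ modeFamilies n m := by
    intro r hr
    simp only [L, H, Finset.mem_union, Finset.mem_image, Finset.mem_univ, true_and] at hr
    rw [mem_modeFamilies]
    intro i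
    rcases hr with ⟨σ, rfl⟩ | ⟨σ, rfl⟩
    · have := (σ i).2
      simp only [lowModes]
      omega
    · have := (σ i).2
      simp only [highModes]
      omega
  have key : ∀ k : ℕ, (numStandardWalksC n m η k : ℝ) - (2 / m : ℝ) ^ n * topEigenvalue n m ^ k *
      (Matrix.of fun i j => sineMode m (lowModes n i) (η j)).det *
      (modeSum m (lowModes n) + (-1) ^ k * ((-1) ^ n * (-1) ^ (∑ i, η i)) *
        modeSum m (highModes n m)) =
      ∑ r ∈ modeFamilies n m \ (L ∪ H),
        (2 / m : ℝ) ^ n * modeTerm m η r * modeEigenvalue m r ^ k := fun k => by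
    rw [numStandardWalksC_eq (by omega) k hη, ← Finset.sum_sdiff hsub, Finset.sum_union hLH,
      sum_image_perm (lowModes_injective n) fun r => modeEigenvalue m r ^ k * modeTerm m η r,
      sum_image_perm (highModes_injective n m) fun r => modeEigenvalue m r ^ k * modeTerm m η r,
      sum_perm_modeTerm, sum_perm_modeTerm, modeEigenvalue_highModes (by omega),
      modeEigenvalue_lowModes_eq_topEigenvalue (by omega), det_highModes (by omega),
      neg_pow (topEigenvalue n m), mul_add, Finset.mul_sum]
    have : ∀ r, (2 / m : ℝ) ^ n * modeTerm m η r * modeEigenvalue m r ^ k =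
        (2 / m : ℝ) ^ n * (modeEigenvalue m r ^ k * modeTerm m η r) := fun r => by ring
    simp only [this]
    ring
  simp only [key]
  refine IsLittleO.fun_sum fun r hr => ?_
  rw [Finset.mem_sdiff] at hr
  rcases dominating_or_lt hn (by omega) η hr.1 with ⟨σ, h1⟩ | ⟨σ, h1⟩ | h1 | h1
  · exact absurd (Finset.mem_union_left _ (Finset.mem_image.2 ⟨σ, Finset.mem_univ _, h1.symm⟩)) hr.2
  · exact absurd (Finset.mem_union_right _ (Finset.mem_image.2 ⟨σ, Finset.mem_univ _, h1.symm⟩)) hr.2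
  · simp [h1]
  · exact (isLittleO_pow_pow_of_abs_lt_left (h1.trans_le (le_abs_self _))).const_mul_left _

theorem neg_one_mul_self_pow (a : ℕ) (b : ℤ) : ((-1 : ℝ) ^ a * (-1) ^ b) = 1 ∨
    ((-1 : ℝ) ^ a * (-1) ^ b) = -1 := by
  rw [← mul_self_eq_one_iff, mul_mul_mul_comm, ← mul_pow, ← mul_zpow]
  simp

theorem numStandardWalksC_isEquivalent {n m : ℕ} (hn : 0 < n) (h : n < m)
    {η : Fin n → ℤ} (hη : η ∈ strictAntiSeqs n (m - 1)) :
    (fun k : ℕ => (numStandardWalksC n m η k : ℝ)) ~[atTop] fun k : ℕ =>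
      (2 / m : ℝ) ^ n * topEigenvalue n m ^ k *
      (Matrix.of fun i j => sineMode m (lowModes n i) (η j)).det *
      (modeSum m (lowModes n) + (-1) ^ k * ((-1) ^ n * (-1) ^ (∑ i, η i)) *
        modeSum m (highModes n m)) := by
  rcases (Nat.succ_le_of_lt h).lt_or_eq with h' | h'
  · refine (numStandardWalksC_sub_isLittleO hn h' hη).trans_isBigO ?_
    have hpos := topEigenvalue_pos hn h'
    have hη' := mem_strictAntiSeqs_sub_one.1 hη
    have hdet : 0 < (Matrix.of fun i j => sineMode m (lowModes n i) (η j)).det :=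
      det_sineMode_pos η hη'.2 hη'.1
    have hm : (0 : ℝ) < m := by
      have : 0 < m := by omega
      positivity
    have p1 := modeSum_add_sign_mul_pos hn h' 1 (Or.inl rfl)
    have p2 := modeSum_add_sign_mul_pos hn h' (-1) (Or.inr rfl)
    set A := (2 / m : ℝ) ^ n * (Matrix.of fun i j => sineMode m (lowModes n i) (η j)).det with hA
    have hA0 : 0 < A := by positivity
    -- The last bracket takes at most two values as k varies; both are positive, so `c` bounds it
    -- from below.
    set c := min (modeSum m (lowModes n) + 1 * modeSum m (highModes n m))
      (modeSum m (lowModes n) + -1 * modeSum m (highModes n m)) with hc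
    have hc0 : 0 < c := lt_min p1 p2
    refine IsBigO.of_bound (A * c)⁻¹ (Eventually.of_forall fun k => ?_)
    have hb : c ≤ modeSum m (lowModes n) + (-1) ^ k * ((-1) ^ n * (-1) ^ (∑ i, η i)) *
        modeSum m (highModes n m) := by
      rw [← mul_assoc, ← pow_add]
      rcases neg_one_mul_self_pow (k + n) (∑ i, η i) with h1 | h1 <;> rw [h1]
      · exact min_le_left _ _
      · exact min_le_right _ _
    have hpk : 0 < topEigenvalue n m ^ k := pow_pos hpos k
    rw [Real.norm_of_nonneg hpk.le, inv_mul_eq_div, le_div_iff₀ (by positivity)]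
    refine le_trans ?_ (le_abs_self _)
    calc topEigenvalue n m ^ k * (A * c) ≤ topEigenvalue n m ^ k * (A *
        (modeSum m (lowModes n) + (-1) ^ k * ((-1) ^ n * (-1) ^ (∑ i, η i)) *
        modeSum m (highModes n m))) := by gcongr
      _ = _ := by rw [hA]; ring
  · refine EventuallyEq.isEquivalent ?_
    filter_upwards [eventually_gt_atTop 0] with k hk
    rw [numStandardWalksC_eq_zero_of_succ_eq hn h' hη hk, topEigenvalue_eq_zero h',
      zero_pow hk.ne']
    ring

/-- Joins the sign (-1)^n from `det_highModes` with that of the reflected pairs: n(n+1)/2 and ⌈n/2⌉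
have equal parity. -/
theorem neg_one_pow_sum_range (n : ℕ) :
    (-1 : ℝ) ^ n * (-1) ^ (∑ i ∈ Finset.range n, i) = (-1) ^ ((n + 1) / 2) := by
  rw [← pow_add, add_comm, ← Finset.sum_range_succ (fun i => i)]
  have step : ∀ n, (-1 : ℝ) ^ (∑ i ∈ Finset.range (n + 2 + 1), i) =
      -(-1) ^ (∑ i ∈ Finset.range (n + 1), i) := fun n => by
    rw [Finset.sum_range_succ, Finset.sum_range_succ, pow_add, pow_add, mul_assoc, ← pow_add,
      show n + 1 + (n + 2) = 2 * (n + 1) + 1 by ring, pow_succ, pow_mul]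
    simp
  induction n using Nat.twoStepInduction with
  | zero => simp
  | one => simp [Finset.sum_range_succ]
  | more n h1 _ =>
    rw [step, h1, show (n + 2 + 1) / 2 = (n + 1) / 2 + 1 by omega, pow_succ]
    ring

/-- The asymptotic formula in terms of the quotient of the two dominating sums of modes. -/
theorem commonFactorC_mul_eq {n m : ℕ} (h : n < m) (η : Fin n → ℤ) (k q : ℕ) (T : ℝ)
    (hq : q = (n + 1) / 2)
    (hT : modeSum m (highModes n m) =
      (-1) ^ (∑ i ∈ Finset.range n, i) * T * modeSum m (lowModes n)) :
    (2 / m : ℝ) ^ n * topEigenvalue n m ^ k *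
      (Matrix.of fun i j => sineMode m (lowModes n i) (η j)).det *
      (modeSum m (lowModes n) + (-1) ^ k * ((-1) ^ n * (-1) ^ (∑ i, η i)) *
        modeSum m (highModes n m)) =
    commonFactorC n m η k * (sineQuotientC n m +
      (-1 : ℝ) ^ ((∑ i, η i) + (k : ℤ) + (q : ℤ)) * ((2 : ℝ) ^ (n ^ 2))⁻¹ *
        (T / absSineProductC n m)) := by
  have hP := (absSineProductC_pos h).ne'
  rw [zpow_add₀ (by norm_num), zpow_add₀ (by norm_num), zpow_natCast, zpow_natCast, hq,
    ← neg_one_pow_sum_range, hT, commonFactorC_eq h, sineQuotientC_eq h]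
  simp only [show ∀ i : Fin n, (i : ℤ) + 1 = lowModes n i from fun _ => rfl]
  field_simp

theorem mainTheorem9 (n m : ℕ) (hn : 0 < n) (hm : 0 < m) (η : Fin n → ℤ)
    (hη : (fun i => (η i : ℝ)) ∈ alcoveC n (m : ℝ)) :
    (Even m → Even n →
      (fun k : ℕ => (numStandardWalksC n m η k : ℝ)) ~[atTop] fun k : ℕ =>
        commonFactorC n m η k *
          (sineQuotientC n m +
            (-1 : ℝ) ^ ((∑ i, η i) + (k : ℤ) + ((n / 2 : ℕ) : ℤ)) * ((2 : ℝ) ^ (n ^ 2))⁻¹ *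
              ((∏ h ∈ Finset.Icc 1 (n / 2),
                  Real.tan ((2 * (h : ℝ) - 1) * Real.pi / (2 * m)) ^ 2) /
                absSineProductC n m))) ∧
    (Even m → Odd n →
      (fun k : ℕ => (numStandardWalksC n m η k : ℝ)) ~[atTop] fun k : ℕ =>
        commonFactorC n m η k *
          (sineQuotientC n m +
            (-1 : ℝ) ^ ((∑ i, η i) + (k : ℤ) + (((n + 1) / 2 : ℕ) : ℤ)) *
              ((2 : ℝ) ^ (n ^ 2))⁻¹ *
              ((∏ h ∈ Finset.Icc 1 ((n + 1) / 2),
                  Real.tan ((2 * (h : ℝ) - 1) * Real.pi / (2 * m)) ^ 2) /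
                absSineProductC n m))) ∧
    (Odd m → Even n →
      (fun k : ℕ => (numStandardWalksC n m η k : ℝ)) ~[atTop] fun k : ℕ =>
        commonFactorC n m η k *
          (sineQuotientC n m +
            (-1 : ℝ) ^ ((∑ i, η i) + (k : ℤ) + ((n / 2 : ℕ) : ℤ)) * ((2 : ℝ) ^ (n ^ 2))⁻¹ *
              (∏ h ∈ Finset.Icc 1 (n / 2),
                Real.sin ((2 * (h : ℝ) - 1) * Real.pi / (2 * m)) ^ 2 /
                  Real.cos ((h : ℝ) * Real.pi / m) ^ 2) *
              (1 / absSineProductC n m))) ∧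
    (Odd m → Odd n →
      (fun k : ℕ => (numStandardWalksC n m η k : ℝ)) ~[atTop] fun k : ℕ =>
        commonFactorC n m η k * sineQuotientC n m) := by
  rw [mem_alcoveC_iff_mem_strictAntiSeqs] at hη
  have h : n < m := by
    have h1 := mem_strictAntiSeqs_sub_one.1 hη
    have hc := Finset.card_le_card_of_injOn η (s := Finset.univ) (t := Finset.Ioo (0 : ℤ) m)
      (fun i _ => by simpa using h1.1 i) h1.2.injective.injOn
    simp at hc
    omega
  have main := numStandardWalksC_isEquivalent hn h hη
  refine ⟨fun hme hne => ?_, fun hme hno => ?_, fun hmo hne => ?_, fun hmo hno => ?_⟩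
  · have hq : n / 2 = (n + 1) / 2 := by obtain ⟨p, rfl⟩ := hne; omega
    have hT := modeSum_high_of_even h hme
    rw [← hq] at hT
    simpa only [commonFactorC_mul_eq h η _ _ _ hq hT] using main
  · simpa only [commonFactorC_mul_eq h η _ _ _ rfl (modeSum_high_of_even h hme)] using main
  · have hq : n / 2 = (n + 1) / 2 := by obtain ⟨p, rfl⟩ := hne; omega
    simp only [commonFactorC_mul_eq h η _ _ _ hq (modeSum_high_of_odd h hmo hne)] at main
    simpa only [mul_assoc, mul_one_div, mul_div_assoc] using main
  · have hT : modeSum m (highModes n m) =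
      (-1) ^ (∑ i ∈ Finset.range n, i) * 0 * modeSum m (lowModes n) := by
      rw [mul_zero, zero_mul]
      exact modeSum_high_of_odd_of_odd h hmo hno
    simpa only [commonFactorC_mul_eq h η _ _ _ rfl hT, zero_div, mul_zero, add_zero] using main
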